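/- Let $K$ be a field of characteristic $0$ (for example $\mathbb{R}$ or $\mathbb{C}$). For a symmetric matrix $Q\in M_n(\mathbb{Q})$ with associated quadratic form $\mathfrak{q}(v)=v^{\mathrm t}Qv$ on $\mathbb{Q}^n$, let $$\mathrm{SO}_{\mathfrak q}(K)=\{g\in \mathrm{GL}_n(K) : g^{\mathrm t}Qg=Q,\ \det g=1\},$$ and let $\mathrm{SO}_{\mathfrak q}(\mathbb{Z})$ be the subgroup of those elements that have integral entries, as do their inverses. A subgroup of $\mathrm{SO}_{\mathfrak q}(K)$ is Zariski dense if every polynomial over $K$ in the matrix entries that vanishes on it vanishes on $\mathrm{SO}_{\mathfrak q}(K)$. A conjugation $\phi\colon\mathrm{SO}_{\mathfrak q_1}\to\mathrm{SO}_{\mathfrak q_2}$ is a homomorphism $\mathrm{SO}_{\mathfrak q_1}(K)\to\mathrm{SO}_{\mathfrak q_2}(K)$ of the form $x\mapsto gxg^{-1}$ with $g\in\mathrm{GL}_n(K)$. It is defined over $\mathbb{Q}$ if the matrix entries of $\phi(x)$ are polynomials with rational coefficients in the matrix entries of $x$. Let $\mathfrak q_1,\mathfrak q_2$ be rational quadratic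 forms in $n$ variables, and let $\Gamma_i\leq \mathrm{SO}_{\mathfrak q_i}(\mathbb{Z})$ be Zariski dense in $\mathrm{SO}_{\mathfrak q_i}$ for $i=1,2$. (1) Let $\phi\colon \mathrm{SO}_{\mathfrak q_1}\to\mathrm{SO}_{\mathfrak q_2}$ be a conjugation such that $\phi(\Gamma_1)\cap\Gamma_2$ is Zariski dense in $\mathrm{SO}_{\mathfrak q_2}$. Then $\phi$ is defined over $\mathbb{Q}$. If moreover $n$ is odd and $\mathfrak q_1,\mathfrak q_2$ are non-degenerate, then $\mathfrak q_1$ and $\mathfrak q_2$ are similar over $\mathbb{Q}$ (that is, $\mathfrak q_1$ is isometric to $\lambda\mathfrak q_2$ for some $\lambda\in\mathbb{Q}^\ast$), and they are isometric over $\mathbb{Q}$ if their discriminants in $\mathbb{Q}^\ast/(\mathbb{Q}^\ast)^2$ are equal. (2) Suppose that $\mathfrak q_1,\mathfrak q_2$ are non-degenerate and that either $n\equiv 1\pmod 4$, or $n$ is odd and $\mathfrak q_1,\mathfrak q_2$ have the same discriminant. For a prime $p$ and a form that is isometric over $\mathbb{Q}$ to $\sum_i a_i x_i^2$, the Hasse–Witt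 invariant at $p$ is $W_p=\prod_{i<j}(a_i,a_j)_p$. Here the Hilbert symbol $(a,b)_p$ is $+1$ if $ax^2+by^2-z^2$ has a zero in $\mathbb{Q}_p^3\setminus\{0\}$, and $-1$ otherwise. If $W_p(\mathfrak q_1)\neq W_p(\mathfrak q_2)$ for some prime $p$, computed from any diagonalisations of the two forms, then there is no conjugation $\phi\colon \mathrm{SO}_{\mathfrak q_1}\to\mathrm{SO}_{\mathfrak q_2}$ such that $\phi(\Gamma_1)\cap\Gamma_2$ is Zariski dense in $\mathrm{SO}_{\mathfrak q_2}$. In particular this applies when $\Gamma_1,\Gamma_2$ are thin, that is, Zariski dense and of infinite index in $\mathrm{SO}_{\mathfrak q_i}(\mathbb{Z})$. -/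

import Mathlib

open Matrix

noncomputable section

namespace OrthogonalForms

variable {n : ℕ}

/-- `SO_q(K)`: the group of all `g ∈ GL_n(K)` with `gᵗ Q g = Q` and `det g = 1`, where the
rational matrix `Q` is the matrix of the quadratic form `q`. -/
def SO (K : Type*) [Field K] [CharZero K] (Q : Matrix (Fin n) (Fin n) ℚ) :
    Subgroup (GL (Fin n) K) where
  carrier := {g | (g : Matrix (Fin n) (Fin n) K)ᵀ * Q.map (algebraMap ℚ K) * g
      = Q.map (algebraMap ℚ K) ∧ (g : Matrix (Fin n) (Fin n) K).det = 1}
  one_mem' := by simp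
  mul_mem' := by
    rintro a b ⟨ha, ha'⟩ ⟨hb, hb'⟩
    refine ⟨?_, by simp [ha', hb']⟩
    rw [Units.val_mul, Matrix.transpose_mul]
    calc _ = (b : Matrix (Fin n) (Fin n) K)ᵀ
          * ((a : Matrix (Fin n) (Fin n) K)ᵀ * Q.map (algebraMap ℚ K) * a) * b := by
            simp only [Matrix.mul_assoc]
      _ = _ := by rw [ha, hb]
  inv_mem' := by
    rintro a ⟨ha, ha'⟩
    have h1 : (a : Matrix (Fin n) (Fin n) K) * (a⁻¹ : GL (Fin n) K) = 1 := a.mul_inv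
    refine ⟨?_, ?_⟩
    · generalize ((a⁻¹ : GL (Fin n) K) : Matrix (Fin n) (Fin n) K) = b at h1 ⊢
      generalize (a : Matrix (Fin n) (Fin n) K) = a at h1 ha
      generalize Q.map (algebraMap ℚ K) = R at ha ⊢
      calc bᵀ * R * b = bᵀ * (aᵀ * R * a) * b := by rw [ha]
        _ = (a * b)ᵀ * R * (a * b) := by
            rw [Matrix.transpose_mul]; simp only [Matrix.mul_assoc]
        _ = R := by rw [h1]; simp
    · have := congrArg Matrix.det h1
      rwa [Matrix.det_mul, ha', one_mul, Matrix.det_one] at this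

variable {K : Type*} [Field K] [CharZero K] {Q Q₁ Q₂ : Matrix (Fin n) (Fin n) ℚ}

/-- `SO_q(ℤ)`: the elements of `SO_q(K)` that have integral entries, as do their inverses. -/
def integralPoints (K : Type*) [Field K] [CharZero K] (Q : Matrix (Fin n) (Fin n) ℚ) :
    Subgroup (SO K Q) :=
  (Matrix.GeneralLinearGroup.map (n := Fin n) (Int.castRingHom K)).range.subgroupOf (SO K Q)

/-- The matrix entries of an element of `SO_q(K)`, as a point of affine `n²`-space. -/
def entries (x : SO K Q) (ij : Fin n × Fin n) : K :=
  ((x : GL (Fin n) K) : Matrix (Fin n) (Fin n) K) ij.1 ij.2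

/-- `Γ` is Zariski dense in `SO_q`: a polynomial in the matrix entries that vanishes on `Γ`
vanishes on all of `SO_q(K)`. -/
def IsZariskiDense (Γ : Subgroup (SO K Q)) : Prop :=
  ∀ f : MvPolynomial (Fin n × Fin n) K,
    (∀ x ∈ Γ, MvPolynomial.eval (entries x) f = 0) →
      ∀ x : SO K Q, MvPolynomial.eval (entries x) f = 0

/-- `φ` is a conjugation: `φ(x) = g x g⁻¹` for some `g ∈ GL_n(K)`. -/
def IsConjugation (φ : SO K Q₁ →* SO K Q₂) : Prop :=
  ∃ g : GL (Fin n) K, ∀ x : SO K Q₁, (φ x : GL (Fin n) K) = g * x * g⁻¹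

/-- `φ` is a morphism defined over `ℚ`: the matrix entries of `φ(x)` are polynomials with
rational coefficients in the matrix entries of `x`. -/
def IsDefinedOverRat (φ : SO K Q₁ →* SO K Q₂) : Prop :=
  ∃ P : Fin n × Fin n → MvPolynomial (Fin n × Fin n) ℚ,
    ∀ (x : SO K Q₁) (ij : Fin n × Fin n),
      entries (φ x) ij = MvPolynomial.aeval (entries x) (P ij)

/-- The rational quadratic form `v ↦ vᵗ Q v` on `ℚⁿ`. -/
def form (Q : Matrix (Fin n) (Fin n) ℚ) : QuadraticForm ℚ (Fin n → ℚ) :=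
  Q.toQuadraticForm'

/-- Isometry over `ℚ`. -/
def IsometricForms (Q₁ Q₂ : Matrix (Fin n) (Fin n) ℚ) : Prop :=
  (form Q₁).Equivalent (form Q₂)

/-- Similarity over `ℚ`: `q₁` is isometric to `c q₂` for a non-zero rational `c`. -/
def SimilarForms (Q₁ Q₂ : Matrix (Fin n) (Fin n) ℚ) : Prop :=
  ∃ c : ℚ, c ≠ 0 ∧ (form Q₁).Equivalent (c • form Q₂)

/-- Equality of discriminants, that is, of determinants modulo squares of `ℚˣ`. -/
def SameDiscriminant (Q₁ Q₂ : Matrix (Fin n) (Fin n) ℚ) : Prop :=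
  ∃ c : ℚ, c ≠ 0 ∧ Q₁.det = c ^ 2 * Q₂.det

/-- `∑ dᵢ xᵢ²` is a diagonal form of `q` over `ℚ`. -/
def IsDiagonalForm (Q : Matrix (Fin n) (Fin n) ℚ) (d : Fin n → ℚ) : Prop :=
  (form Q).Equivalent (QuadraticMap.weightedSumSquares ℚ d)

theorem exists_isDiagonalForm (Q : Matrix (Fin n) (Fin n) ℚ) :
    ∃ d : Fin n → ℚ, IsDiagonalForm Q d := by
  obtain ⟨w, hw⟩ := QuadraticForm.equivalent_weightedSumSquares (form Q)
  have hn : Module.finrank ℚ (Fin n → ℚ) = n := by simp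
  revert w
  rw [hn]
  exact fun w hw => ⟨w, hw⟩

open Classical in
/-- The Hilbert symbol of `ℚ_p`: it is `1` if `a x² + b y² - z²` has a non-trivial zero over
`ℚ_p`, and `-1` otherwise. -/
def hilbertSymbol (p : ℕ) [Fact p.Prime] (a b : ℚ_[p]) : ℤ :=
  if ∃ x y z : ℚ_[p], (x, y, z) ≠ (0, 0, 0) ∧ a * x ^ 2 + b * y ^ 2 - z ^ 2 = 0 then 1 else -1

/-- The Hasse–Witt invariant at `p` of the diagonal form `∑ dᵢ xᵢ²`: the product of the Hilbert
symbols of `dᵢ` and `dⱼ` over all `i < j`. -/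
def hasseWitt (p : ℕ) [Fact p.Prime] (d : Fin n → ℚ) : ℤ :=
  ∏ i : Fin n, ∏ j ∈ Finset.Ioi i, hilbertSymbol p (d i : ℚ_[p]) (d j : ℚ_[p])

end OrthogonalForms

end

open Matrix

noncomputable section

namespace OrthogonalForms

variable {n : ℕ}

/-! Let φ be conjugation by g. For x ∈ Γ₁ with φ(x) ∈ Γ₂, both x and φ(x) are rational, so the
equation g x = φ(x) g survives when a ℚ-linear functional ψ : K → ℚ is applied to the entries of g.
Some ψ keeps the determinant non-zero (`exists_linearMap_det_map_ne_zero`), and density spreads the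
equation for h = ψ(g) to the whole group (`exists_rat_conjugator`). Hence φ is conjugation by a
rational matrix.

The form hᵗ Q₂ h is then invariant under SO_{q₁}. For odd n the negatives of reflections lie in
SO_{q₁}, and they force hᵗ Q₂ h = c Q₁ (`exists_eq_smul_of_invariant`): this is similarity.
Comparing determinants shows that c is a square when the discriminants agree.

Part (2) needs the Hasse–Witt invariant to be independent of the diagonalisation. Orthogonal bases
are linked by rescaling, reordering and changes of two vectors at a time, so a function of one
diagonal entry that respects the binary Witt relations has an invariant product
(`prod_eq_prod_of_span_eq`). The Hasse–Witt invariant becomes such a product in an extension of ℚ_pˣ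
twisted by the Hilbert symbol (`TwistedProduct.snd_prod_of`). This uses that the symbol is
bimultiplicative, which holds because norm values have index at most two in ℚ_pˣ
(`exists_isNormValue_or_mul`). Finally, scaling a form by c multiplies the invariant by (c,c)^(n
choose 2) (c,∏dᵢ)^(n-1), which is 1 for n ≡ 1 mod 4. -/

/-- An invertible matrix over an extension of an infinite field `k` stays invertible after applying
a suitable `k`-linear functional to its entries. -/
theorem exists_linearMap_det_map_ne_zero {k L ι : Type*} [Field k] [Infinite k] [Field L]
    [Algebra k L] [Fintype ι] [DecidableEq ι] (g : Matrix ι ι L) (hg : g.det ≠ 0) :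
    ∃ ψ : L →ₗ[k] k, (g.map ψ).det ≠ 0 := by
  let b := Module.Basis.ofVectorSpace k L
  let X : L →ₗ[k] MvPolynomial _ k := b.constr k MvPolynomial.X
  have hX : ∀ x, MvPolynomial.aeval b (X x) = x := by
    intro x
    have : (MvPolynomial.aeval (R := k) b).toLinearMap ∘ₗ X = LinearMap.id :=
      b.ext fun i => by simp [X]
    exact LinearMap.congr_fun this x
  -- Replacing each basis vector of L by a variable turns det g into a polynomial over k. It is
  -- non-zero because it specialises to det g at the basis; its values at points of k are the
  -- determinants of the images of g under functionals.
  have hdet : (g.map X).det ≠ 0 := by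
    intro h0
    apply hg
    have := congrArg (MvPolynomial.aeval (R := k) b) h0
    rw [AlgHom.map_det, map_zero] at this
    rw [← this]
    congr 1
    ext i j
    simp [hX]
  by_contra! hψ
  apply hdet
  apply MvPolynomial.funext
  intro t
  rw [map_zero, RingHom.map_det, ← hψ (b.constr k t)]
  congr 1
  ext i j
  have : (MvPolynomial.aeval (R := k) t).toLinearMap ∘ₗ X = b.constr k t :=
    b.ext fun i => by simp [X]
  simpa [MvPolynomial.aeval_eq_eval] using LinearMap.congr_fun this (g i j)

/-! ### Descent of the conjugating matrix to ℚ -/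

section

variable {K : Type*} [Field K] [CharZero K] {Q Q₁ Q₂ : Matrix (Fin n) (Fin n) ℚ}

theorem map_linearMap_mul_map {k L ι : Type*} [Field k] [Field L] [Algebra k L] [Fintype ι]
    (ψ : L →ₗ[k] k) (g : Matrix ι ι L) (x : Matrix ι ι k) :
    (g * x.map (algebraMap k L)).map ψ = g.map ψ * x := by
  ext i j
  simp only [map_apply, mul_apply, map_sum]
  refine Finset.sum_congr rfl fun l _ => ?_
  rw [mul_comm (g i l), ← Algebra.smul_def, map_smul, smul_eq_mul, mul_comm]

theorem map_linearMap_map_mul {k L ι : Type*} [Field k] [Field L] [Algebra k L] [Fintype ι]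
    (ψ : L →ₗ[k] k) (g : Matrix ι ι L) (x : Matrix ι ι k) :
    (x.map (algebraMap k L) * g).map ψ = x * g.map ψ := by
  ext i j
  simp only [map_apply, mul_apply, map_sum]
  refine Finset.sum_congr rfl fun l _ => ?_
  rw [← Algebra.smul_def, map_smul, smul_eq_mul]

theorem exists_eq_map_of_mem_integralPoints {x : SO K Q} (hx : x ∈ integralPoints K Q) :
    ∃ a : Matrix (Fin n) (Fin n) ℚ,
      ((x : GL (Fin n) K) : Matrix (Fin n) (Fin n) K) = a.map (algebraMap ℚ K) := by
  obtain ⟨y, hy⟩ := hx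
  refine ⟨(y : Matrix (Fin n) (Fin n) ℤ).map (Int.castRingHom ℚ), ?_⟩
  have : (x : GL (Fin n) K) = _ := hy.symm
  rw [this]
  ext i j
  simp

/-- Linear relations between the matrix entries extend from a Zariski dense subgroup. -/
theorem IsZariskiDense.mul_eq_mul {Γ : Subgroup (SO K Q)} (hΓ : IsZariskiDense Γ)
    {A B C D : Matrix (Fin n) (Fin n) K}
    (h : ∀ x ∈ Γ, A * ((x : GL (Fin n) K) : Matrix (Fin n) (Fin n) K) * B
      = C * ((x : GL (Fin n) K) : Matrix (Fin n) (Fin n) K) * D) (x : SO K Q) :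
    A * ((x : GL (Fin n) K) : Matrix (Fin n) (Fin n) K) * B
      = C * ((x : GL (Fin n) K) : Matrix (Fin n) (Fin n) K) * D := by
  let Y := Matrix.mvPolynomialX (Fin n) (Fin n) K
  let c : K →+* MvPolynomial (Fin n × Fin n) K := MvPolynomial.C
  let F := c.mapMatrix A * Y * c.mapMatrix B - c.mapMatrix C * Y * c.mapMatrix D
  have hF : ∀ (x : SO K Q), (MvPolynomial.eval (entries x)).mapMatrix F
      = A * ((x : GL (Fin n) K) : Matrix (Fin n) (Fin n) K) * B
        - C * ((x : GL (Fin n) K) : Matrix (Fin n) (Fin n) K) * D := by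
    intro x
    have hY : (MvPolynomial.eval (entries x)).mapMatrix Y = (x : GL (Fin n) K) :=
      Matrix.mvPolynomialX_mapMatrix_eval _
    have hc : ∀ M : Matrix (Fin n) (Fin n) K,
        (MvPolynomial.eval (entries x)).mapMatrix (c.mapMatrix M) = M := by
      intro M
      ext i j
      simp [c]
    simp only [F, map_sub, map_mul, hY, hc]
  rw [← sub_eq_zero, ← hF]
  ext i j
  refine hΓ (F i j) (fun y hy => ?_) x
  have := congrFun (congrFun (hF y) i) j
  rw [sub_eq_zero.mpr (h y hy)] at this
  simpa using this

theorem exists_rat_conjugator {Γ₁ : Subgroup (SO K Q₁)} {Γ₂ : Subgroup (SO K Q₂)}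
    (hΓ₁ : Γ₁ ≤ integralPoints K Q₁) (hΓ₂ : Γ₂ ≤ integralPoints K Q₂)
    {φ : SO K Q₁ →* SO K Q₂} (hφ : IsConjugation φ) (hd : IsZariskiDense (Γ₁.map φ ⊓ Γ₂)) :
    ∃ h : Matrix (Fin n) (Fin n) ℚ, h.det ≠ 0 ∧ ∀ x : SO K Q₁,
      h.map (algebraMap ℚ K) * ((x : GL (Fin n) K) : Matrix (Fin n) (Fin n) K)
        = ((φ x : GL (Fin n) K) : Matrix (Fin n) (Fin n) K) * h.map (algebraMap ℚ K) := by
  obtain ⟨g, hg⟩ := hφ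
  obtain ⟨ψ, hψ⟩ := exists_linearMap_det_map_ne_zero (k := ℚ) (g : Matrix (Fin n) (Fin n) K)
    (Matrix.GeneralLinearGroup.det_ne_zero g)
  have hgx : ∀ x : SO K Q₁, (g : Matrix (Fin n) (Fin n) K) * ((x : GL (Fin n) K) : Matrix _ _ K)
      = ((φ x : GL (Fin n) K) : Matrix (Fin n) (Fin n) K) * (g : Matrix (Fin n) (Fin n) K) := by
    intro x
    rw [hg x]
    rw [← Units.val_mul, ← Units.val_mul, inv_mul_cancel_right]
  refine ⟨(g : Matrix (Fin n) (Fin n) K).map ψ, hψ, fun x => ?_⟩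
  set H := ((g : Matrix (Fin n) (Fin n) K).map ψ).map (algebraMap ℚ K) with hH
  -- With y = φ(x) and x = g⁻¹ y g, the wanted relation H x = φ(x) H becomes H g⁻¹ y g = y H. It is
  -- linear in y, so density inside SO_{q₂} applies.
  have key := hd.mul_eq_mul (A := H * ((g⁻¹ : GL (Fin n) K) : Matrix (Fin n) (Fin n) K)) (B := g) (C := 1) (D := H) ?_ (φ x)
  · rw [mul_assoc, ← hgx] at key
    simpa [mul_assoc, ← mul_assoc ((g : Matrix (Fin n) (Fin n) K)⁻¹)] using key
  · rintro _ ⟨⟨y, hy, rfl⟩, hy₂⟩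
    obtain ⟨a, ha⟩ := exists_eq_map_of_mem_integralPoints (hΓ₁ hy)
    obtain ⟨b, hb⟩ := exists_eq_map_of_mem_integralPoints (hΓ₂ hy₂)
    have h1 := hgx y
    rw [mul_assoc, ← h1]
    rw [ha, hb] at h1
    have h2 := congrArg (fun M : Matrix (Fin n) (Fin n) K => M.map ψ) h1
    simp only [map_linearMap_mul_map, map_linearMap_map_mul] at h2
    have h3 : H * a.map (algebraMap ℚ K) = b.map (algebraMap ℚ K) * H := by
      rw [hH, ← Matrix.map_mul, ← Matrix.map_mul, h2]
    rw [ha, hb, one_mul, ← h3]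
    simp [mul_assoc, ← mul_assoc ((g : Matrix (Fin n) (Fin n) K)⁻¹)]

theorem isDefinedOverRat_of_conjugator {φ : SO K Q₁ →* SO K Q₂} {h : Matrix (Fin n) (Fin n) ℚ}
    (hdet : h.det ≠ 0)
    (hx : ∀ x : SO K Q₁,
      h.map (algebraMap ℚ K) * ((x : GL (Fin n) K) : Matrix (Fin n) (Fin n) K)
        = ((φ x : GL (Fin n) K) : Matrix (Fin n) (Fin n) K) * h.map (algebraMap ℚ K)) :
    IsDefinedOverRat φ := by
  let Y := Matrix.mvPolynomialX (Fin n) (Fin n) ℚ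
  let c : ℚ →+* MvPolynomial (Fin n × Fin n) ℚ := MvPolynomial.C
  let F := c.mapMatrix h * Y * c.mapMatrix h⁻¹
  refine ⟨fun ij => F ij.1 ij.2, fun x ij => ?_⟩
  have hY : (MvPolynomial.aeval (R := ℚ) (entries x)).mapMatrix Y
      = ((x : GL (Fin n) K) : Matrix (Fin n) (Fin n) K) :=
    Matrix.mvPolynomialX_mapMatrix_aeval ℚ _
  have hc : ∀ M : Matrix (Fin n) (Fin n) ℚ,
      (MvPolynomial.aeval (R := ℚ) (entries x)).mapMatrix (c.mapMatrix M)
        = M.map (algebraMap ℚ K) := by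
    intro M
    ext i j
    simp [c]
  have hF : (MvPolynomial.aeval (R := ℚ) (entries x)).mapMatrix F
      = ((φ x : GL (Fin n) K) : Matrix (Fin n) (Fin n) K) := by
    simp only [F, map_mul, hY, hc]
    rw [hx, mul_assoc, ← Matrix.map_mul, Matrix.mul_nonsing_inv _ (Ne.isUnit hdet)]
    simp
  have := congrFun (congrFun hF ij.1) ij.2
  simpa [entries] using this.symm

end

/-! ### Invariant symmetric forms and reflections -/

theorem eq_zero_of_dotProduct_mulVec_self {F ι : Type*} [Field F] [CharZero F] [Fintype ι]
    [DecidableEq ι] {T : Matrix ι ι F} (hT : T.IsSymm) (h : ∀ w, w ⬝ᵥ T *ᵥ w = 0) : T = 0 := by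
  ext i j
  have h1 := h (Pi.single i 1)
  have h2 := h (Pi.single j 1)
  have h3 := h (Pi.single i 1 + Pi.single j 1)
  have h4 : T j i = T i j := hT.apply i j
  simp [mulVec_add, add_dotProduct, dotProduct_add] at h1 h2 h3
  rw [h1, h2, h4] at h3
  simp only [zero_add, add_zero] at h3
  exact add_self_eq_zero.mp h3

theorem dotProduct_mulVec_comm {F ι : Type*} [Field F] [Fintype ι] {T : Matrix ι ι F}
    (hT : T.IsSymm) (v w : ι → F) : v ⬝ᵥ T *ᵥ w = w ⬝ᵥ T *ᵥ v := by
  rw [dotProduct_mulVec, ← mulVec_transpose, hT.eq, dotProduct_comm]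

/-- If every vector that is anisotropic for `Q` has the same orthogonal complement for `S`, then `S`
is a multiple of `Q`. -/
theorem exists_eq_smul_of_forall_anisotropic {F ι : Type*} [Field F] [CharZero F] [Fintype ι]
    [DecidableEq ι] {Q S : Matrix ι ι F} (hQ : Q.IsSymm) (hS : S.IsSymm) (hQ0 : Q ≠ 0)
    (h : ∀ v, v ⬝ᵥ Q *ᵥ v ≠ 0 → ∀ y,
      (v ⬝ᵥ Q *ᵥ v) * (v ⬝ᵥ S *ᵥ y) = (v ⬝ᵥ S *ᵥ v) * (v ⬝ᵥ Q *ᵥ y)) :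
    ∃ c : F, S = c • Q := by
  obtain ⟨v, hv⟩ : ∃ v, v ⬝ᵥ Q *ᵥ v ≠ 0 := by
    by_contra! h0
    exact hQ0 (eq_zero_of_dotProduct_mulVec_self hQ h0)
  set q := v ⬝ᵥ Q *ᵥ v with hq
  set c := (v ⬝ᵥ S *ᵥ v) / q with hc
  refine ⟨c, ?_⟩
  rw [← sub_eq_zero]
  set T := S - c • Q with hTdef
  have hT : T.IsSymm := hS.sub (hQ.smul c)
  have hTapp : ∀ x y, x ⬝ᵥ T *ᵥ y = x ⬝ᵥ S *ᵥ y - c * (x ⬝ᵥ Q *ᵥ y) := by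
    intro x y
    simp [hTdef, sub_mulVec, dotProduct_sub, smul_mulVec]
  have hTv : ∀ y, v ⬝ᵥ T *ᵥ y = 0 := by
    intro y
    rw [hTapp, hc]
    field_simp
    linear_combination h v hv y
  have hT' : ∀ u, u ⬝ᵥ Q *ᵥ u ≠ 0 → ∀ y,
      (u ⬝ᵥ Q *ᵥ u) * (u ⬝ᵥ T *ᵥ y) = (u ⬝ᵥ T *ᵥ u) * (u ⬝ᵥ Q *ᵥ y) := by
    intro u hu y
    rw [hTapp, hTapp]
    linear_combination h u hu y
  refine eq_zero_of_dotProduct_mulVec_self hT fun w => ?_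
  set b := w ⬝ᵥ Q *ᵥ v with hb
  set r := w ⬝ᵥ Q *ᵥ w with hr
  -- The vector v + t w should be anisotropic and not orthogonal to v, with t ≠ 0. Each condition
  -- excludes the roots of a non-zero polynomial in t, two of which have constant term q ≠ 0.
  obtain ⟨t, ht⟩ : ∃ t : F, t * (q + t * b) * (q + 2 * t * b + t ^ 2 * r) ≠ 0 := by
    by_contra! h0
    let P : Polynomial F := .X * (.C q + .X * .C b) * (.C q + 2 * .X * .C b + .X ^ 2 * .C r)
    have hP : P = 0 := Polynomial.funext fun t => by
      simpa only [P, Polynomial.eval_mul, Polynomial.eval_add, Polynomial.eval_X, Polynomial.eval_C,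
        Polynomial.eval_pow, Polynomial.eval_ofNat, Polynomial.eval_zero] using h0 t
    have h1 : (Polynomial.C q + .X * .C b : Polynomial F) ≠ 0 := fun h => hv (by
      simpa using congrArg (Polynomial.eval 0) h)
    have h2 : (.C q + 2 * .X * .C b + .X ^ 2 * .C r : Polynomial F) ≠ 0 := fun h => hv (by
      simpa using congrArg (Polynomial.eval 0) h)
    exact mul_ne_zero (mul_ne_zero Polynomial.X_ne_zero h1) h2 hP
  have ht0 : t ≠ 0 := fun h => ht (by simp [h])
  have ht1 : q + t * b ≠ 0 := fun h => ht (by simp [h])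
  have ht2 : q + 2 * t * b + t ^ 2 * r ≠ 0 := fun h => ht (by simp [h])
  have hwv : v ⬝ᵥ Q *ᵥ w = b := dotProduct_mulVec_comm hQ v w
  have hTwv : w ⬝ᵥ T *ᵥ v = 0 := by rw [dotProduct_mulVec_comm hT, hTv]
  have e1 : (v + t • w) ⬝ᵥ Q *ᵥ (v + t • w) = q + 2 * t * b + t ^ 2 * r := by
    simp only [mulVec_add, add_dotProduct, dotProduct_add, mulVec_smul, smul_dotProduct,
      dotProduct_smul, smul_eq_mul, hwv, ← hb, ← hq, ← hr]
    ring
  -- Since v is in the radical of T, pairing u = v + t w with v gives 0 = T(u,u) Q(u,v) = t² T(w,w)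
  -- (q + t b).
  have key := hT' (v + t • w) (by rwa [e1]) v
  simp only [mulVec_add, add_dotProduct, dotProduct_add, mulVec_smul, smul_dotProduct,
      dotProduct_smul, smul_eq_mul, hwv, ← hb, ← hq, ← hr, hTv, hTwv, mul_zero, add_zero,
      zero_add] at key
  have := mul_eq_zero.mp key.symm
  rcases this with h5 | h5
  · simpa [ht0] using h5
  · exact absurd h5 ht1

/-- The negative of the reflection in the vector `v`. -/
def negReflection {F ι : Type*} [Field F] [Fintype ι] [DecidableEq ι] (Q : Matrix ι ι F)
    (v : ι → F) : Matrix ι ι F :=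
  (2 / (v ⬝ᵥ Q *ᵥ v)) • vecMulVec v (Q *ᵥ v) - 1

section negReflection

variable {F ι : Type*} [Field F] [Fintype ι] [DecidableEq ι] {Q : Matrix ι ι F} {v : ι → F}

theorem negReflection_mulVec (hQ : Q.IsSymm) (y : ι → F) :
    negReflection Q v *ᵥ y = (2 / (v ⬝ᵥ Q *ᵥ v) * (v ⬝ᵥ Q *ᵥ y)) • v - y := by
  rw [negReflection, sub_mulVec, one_mulVec, smul_mulVec, vecMulVec_mulVec,
    dotProduct_comm (Q *ᵥ v) y, dotProduct_mulVec_comm hQ y v]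
  simp [smul_smul]

theorem transpose_negReflection_mul (hQ : Q.IsSymm) (hv : v ⬝ᵥ Q *ᵥ v ≠ 0) :
    (negReflection Q v)ᵀ * Q * negReflection Q v = Q := by
  apply Matrix.ext_of_mulVec_single
  intro j
  refine dotProduct_eq _ _ fun x => ?_
  generalize (Pi.single j 1 : ι → F) = y
  have : ((negReflection Q v)ᵀ * Q * negReflection Q v) *ᵥ y ⬝ᵥ x
      = (negReflection Q v *ᵥ x) ⬝ᵥ Q *ᵥ (negReflection Q v *ᵥ y) := by
    rw [dotProduct_comm, mul_assoc, ← mulVec_mulVec, ← mulVec_mulVec, dotProduct_mulVec,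
      vecMul_transpose]
  rw [this, negReflection_mulVec hQ, negReflection_mulVec hQ, dotProduct_comm _ x]
  simp only [mulVec_sub, sub_dotProduct, dotProduct_sub, mulVec_smul, smul_dotProduct,
    dotProduct_smul, smul_eq_mul, dotProduct_mulVec_comm hQ x v]
  field_simp
  ring

/-- The reflection is a rank-one perturbation of the identity with determinant 1 - 2 = -1. For odd n
the sign (-1)ⁿ compensates, which is what puts its negative into SO_q. -/
theorem det_negReflection (hn : Odd (Fintype.card ι)) (hv : v ⬝ᵥ Q *ᵥ v ≠ 0) :
    (negReflection Q v).det = 1 := by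
  have : negReflection Q v
      = -(1 + replicateCol Unit (-(2 / (v ⬝ᵥ Q *ᵥ v)) • v) * replicateRow Unit (Q *ᵥ v)) := by
    rw [← vecMulVec_eq, negReflection, smul_vecMulVec, neg_smul]
    abel
  have hc : 2 / (v ⬝ᵥ Q *ᵥ v) * (v ⬝ᵥ Q *ᵥ v) = 2 := div_mul_cancel₀ _ hv
  rw [this, det_neg, hn.neg_one_pow, det_one_add_replicateCol_mul_replicateRow, dotProduct_smul,
    dotProduct_comm (Q *ᵥ v), smul_eq_mul]
  linear_combination hc

end negReflection

section

variable {K : Type*} [Field K] [CharZero K] {Q Q₁ Q₂ : Matrix (Fin n) (Fin n) ℚ}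

/-- For odd `n`, a rational form invariant under `SO_q` is a multiple of `q`. -/
theorem exists_eq_smul_of_invariant {S : Matrix (Fin n) (Fin n) ℚ} (hQ : Q.IsSymm) (hS : S.IsSymm)
    (hQ0 : Q ≠ 0) (hn : Odd n)
    (h : ∀ x : SO K Q, ((x : GL (Fin n) K) : Matrix (Fin n) (Fin n) K)ᵀ * S.map (algebraMap ℚ K)
      * ((x : GL (Fin n) K) : Matrix (Fin n) (Fin n) K) = S.map (algebraMap ℚ K)) :
    ∃ c : ℚ, S = c • Q := by
  refine exists_eq_smul_of_forall_anisotropic hQ hS hQ0 fun v hv y => ?_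
  set R := negReflection Q v with hR
  have hRdet : R.det = 1 := det_negReflection (by simpa using hn) hv
  have hdet : (R.map (algebraMap ℚ K)).det = 1 := by
    have := (algebraMap ℚ K).map_det R
    rw [hRdet, map_one] at this
    exact this.symm
  let g : GL (Fin n) K := Matrix.GeneralLinearGroup.mkOfDetNeZero (R.map (algebraMap ℚ K))
    (by rw [hdet]; exact one_ne_zero)
  have hg : (g : Matrix (Fin n) (Fin n) K) = R.map (algebraMap ℚ K) := rfl
  have hmem : g ∈ SO K Q := by
    refine ⟨?_, hdet⟩
    rw [hg, ← transpose_map, ← Matrix.map_mul, ← Matrix.map_mul, transpose_negReflection_mul hQ hv]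
  have h1 := h ⟨g, hmem⟩
  rw [show ((⟨g, hmem⟩ : SO K Q) : GL (Fin n) K) = g from rfl, hg, ← transpose_map,
    ← Matrix.map_mul, ← Matrix.map_mul] at h1
  -- R fixes v and sends y to a multiple of v minus y, so invariance of S reads 2 S(v,y) = (2 Q(v,y)
  -- / Q(v,v)) S(v,v).
  have h2 : Rᵀ * S * R = S := Matrix.map_injective (algebraMap ℚ K).injective h1
  have h3 : v ⬝ᵥ S *ᵥ y = (R *ᵥ v) ⬝ᵥ S *ᵥ (R *ᵥ y) := by
    conv_lhs => rw [← h2]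
    rw [mul_assoc, ← mulVec_mulVec, ← mulVec_mulVec, dotProduct_mulVec, vecMul_transpose]
  rw [hR, negReflection_mulVec hQ, negReflection_mulVec hQ] at h3
  simp only [mulVec_sub, sub_dotProduct, dotProduct_sub, mulVec_smul, smul_dotProduct,
    dotProduct_smul, smul_eq_mul] at h3
  field_simp at h3
  linear_combination (1 / 2) * h3

theorem form_apply (Q : Matrix (Fin n) (Fin n) ℚ) (v : Fin n → ℚ) :
    form Q v = v ⬝ᵥ Q *ᵥ v := by
  simp [form, Matrix.toQuadraticForm', Matrix.toLinearMap₂'_apply']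

theorem equivalent_of_transpose_mul_mul {h : Matrix (Fin n) (Fin n) ℚ} (hdet : h.det ≠ 0) {c : ℚ}
    (hh : Q₁ = c • (hᵀ * Q₂ * h)) : (form Q₁).Equivalent (c • form Q₂) := by
  have hu : IsUnit h.det := Ne.isUnit hdet
  refine ⟨⟨Matrix.toLinearEquiv' h (h.invertibleOfIsUnitDet hu), fun v => ?_⟩⟩
  rw [hh]
  change c * form Q₂ (h *ᵥ v) = _
  rw [form_apply, form_apply, smul_mulVec, dotProduct_smul, mul_assoc, ← mulVec_mulVec,
    ← mulVec_mulVec, dotProduct_mulVec v, vecMul_transpose, smul_eq_mul]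

/-- As h intertwines x with φ(x), the form hᵗ Q₂ h is SO_{q₁}-invariant and so equals c Q₁. Taking
determinants gives det(h)² det Q₂ = cⁿ det Q₁; for odd n and equal discriminants this makes c a
square, which is absorbed into h. -/
theorem similarForms_of_conjugator (hQ₁ : Q₁.IsSymm) (hQ₂ : Q₂.IsSymm) (h₁ : Q₁.det ≠ 0)
    (h₂ : Q₂.det ≠ 0) (hn : Odd n) {φ : SO K Q₁ →* SO K Q₂} {h : Matrix (Fin n) (Fin n) ℚ}
    (hdet : h.det ≠ 0)
    (hx : ∀ x : SO K Q₁,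
      h.map (algebraMap ℚ K) * ((x : GL (Fin n) K) : Matrix (Fin n) (Fin n) K)
        = ((φ x : GL (Fin n) K) : Matrix (Fin n) (Fin n) K) * h.map (algebraMap ℚ K)) :
    SimilarForms Q₁ Q₂ ∧ (SameDiscriminant Q₁ Q₂ → IsometricForms Q₁ Q₂) := by
  have hQ0 : Q₁ ≠ 0 := by
    rintro rfl
    have : Nonempty (Fin n) := ⟨⟨0, hn.pos⟩⟩
    exact h₁ (Matrix.det_zero)
  obtain ⟨c, hc⟩ := exists_eq_smul_of_invariant (K := K) (S := hᵀ * Q₂ * h) hQ₁ (by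
    rw [IsSymm, transpose_mul, transpose_mul, transpose_transpose, hQ₂.eq, mul_assoc]) hQ0 hn (by
    intro x
    have h3 := (φ x).2.1
    set y := ((φ x : GL (Fin n) K) : Matrix (Fin n) (Fin n) K)
    set X := ((x : GL (Fin n) K) : Matrix (Fin n) (Fin n) K)
    set H := h.map (algebraMap ℚ K)
    set A := Q₂.map (algebraMap ℚ K)
    have h4 : H * X = y * H := hx x
    have h5 : (hᵀ * Q₂ * h).map (algebraMap ℚ K) = Hᵀ * A * H := by
      rw [Matrix.map_mul, Matrix.map_mul, transpose_map]
    rw [h5]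
    calc Xᵀ * (Hᵀ * A * H) * X = (H * X)ᵀ * A * (H * X) := by
          rw [transpose_mul]; simp only [mul_assoc]
      _ = Hᵀ * (yᵀ * A * y) * H := by
          rw [h4, transpose_mul]; simp only [mul_assoc]
      _ = _ := by rw [h3])
  have hdets : h.det ^ 2 * Q₂.det = c ^ n * Q₁.det := by
    have := congrArg Matrix.det hc
    rw [det_mul, det_mul, det_transpose, det_smul, Fintype.card_fin] at this
    linear_combination this
  have hc0 : c ≠ 0 := by
    rintro rfl
    rw [zero_pow hn.pos.ne', zero_mul] at hdets
    exact mul_ne_zero (pow_ne_zero 2 hdet) h₂ hdets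
  have hc' : Q₁ = c⁻¹ • (hᵀ * Q₂ * h) := by rw [hc, smul_smul, inv_mul_cancel₀ hc0, one_smul]
  refine ⟨⟨c⁻¹, inv_ne_zero hc0, equivalent_of_transpose_mul_mul hdet hc'⟩, ?_⟩
  rintro ⟨d, hd0, hd⟩
  obtain ⟨m, rfl⟩ := hn
  rw [hd] at hdets
  have h6 : h.det ^ 2 = c ^ (2 * m + 1) * d ^ 2 := by
    apply mul_right_cancel₀ h₂
    linear_combination hdets
  -- The square root of c is read off from det(h)² = c · (cᵐ d)².
  set s := h.det / (c ^ m * d)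
  have hs : c = s ^ 2 := by
    simp only [s]
    field_simp
    rw [h6]
    ring
  have hs0 : s ≠ 0 := by
    intro h0
    rw [h0] at hs
    simp [hs] at hc0
  have := equivalent_of_transpose_mul_mul (Q₁ := Q₁) (Q₂ := Q₂) (h := s⁻¹ • h) (c := 1) (by
    rw [det_smul]; exact mul_ne_zero (pow_ne_zero _ (inv_ne_zero hs0)) hdet) (by
    rw [hc', hs]
    simp [smul_smul, pow_two])
  rwa [one_smul] at this

end

/-! ### Invariants of orthogonal bases from binary relations -/

section Witt

variable {F V M : Type*} [Field F] [CharZero F] [AddCommGroup V] [Module F V] [CommMonoid M]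

/-- A family of pairwise orthogonal anisotropic vectors. -/
structure IsOrthogonalFamily {ι : Type*} (B : LinearMap.BilinForm F V) (e : ι → V) : Prop where
  ortho : ∀ i j, i ≠ j → B (e i) (e j) = 0
  aniso : ∀ i, B (e i) (e i) ≠ 0

/-- The relations between the one-dimensional forms in the Grothendieck–Witt ring hold for `ε`. -/
structure IsWittInvariant (ε : F → M) : Prop where
  mul_sq : ∀ a c, a ≠ 0 → c ≠ 0 → ε (a * c ^ 2) = ε a
  binary : ∀ a b, a ≠ 0 → b ≠ 0 → a + b ≠ 0 → ε a * ε b = ε (a + b) * ε (a * b * (a + b))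

variable {ι : Type*} [Fintype ι] [DecidableEq ι] {B : LinearMap.BilinForm F V}
  (hB : ∀ x y, B x y = B y x) {ε : F → M} (hε : IsWittInvariant ε)

omit [CharZero F] [Fintype ι] [DecidableEq ι] in
theorem IsOrthogonalFamily.apply_sum_self {e : ι → V} (he : IsOrthogonalFamily B e)
    (s : Finset ι) : B (∑ i ∈ s, e i) (∑ i ∈ s, e i) = ∑ i ∈ s, B (e i) (e i) := by
  simp only [map_sum, LinearMap.sum_apply]
  refine Finset.sum_congr rfl fun i hi => ?_
  rw [Finset.sum_eq_single i (fun j _ hj => he.ortho j i hj) (fun h => absurd hi h)]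

-- If all pairs cancelled, three indices would give 2 aᵢ = 0, and two indices alone would have sum
-- zero.
omit [Fintype ι] in
theorem exists_pair_add_ne_zero {s : Finset ι} {a : ι → F} (ha : ∀ i, a i ≠ 0)
    (hs : 1 < s.card) (hsum : ∑ i ∈ s, a i ≠ 0) :
    ∃ i ∈ s, ∃ j ∈ s, i ≠ j ∧ a i + a j ≠ 0 := by
  by_contra! h
  obtain ⟨i, hi, j, hj, hij⟩ := Finset.one_lt_card.mp hs
  by_cases hk : ∃ k ∈ s, k ≠ i ∧ k ≠ j
  · obtain ⟨k, hk, hki, hkj⟩ := hk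
    have h1 := h i hi j hj hij
    have h2 := h k hk i hi hki
    have h3 := h k hk j hj hkj
    apply ha i
    have : 2 * a i = 0 := by linear_combination h1 + h2 - h3
    simpa using this
  · push Not at hk
    apply hsum
    have : s = {i, j} := by
      ext k
      simp only [Finset.mem_insert, Finset.mem_singleton]
      constructor
      · intro hks
        by_cases hki : k = i
        · exact Or.inl hki
        · exact Or.inr (hk k hks hki)
      · rintro (rfl | rfl) <;> assumption
    rw [this, Finset.sum_pair hij]
    exact h i hi j hj hij

/-- In an orthogonal family, replace two vectors by their sum and an orthogonal vector of the plane
that they span. -/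
def replacePair (B : LinearMap.BilinForm F V) (e : ι → V) (i j : ι) (k : ι) : V :=
  if k = i then e i + e j
  else if k = j then B (e j) (e j) • e i - B (e i) (e i) • e j else e k

omit [CharZero F] [Fintype ι] in
theorem replacePair_left (e : ι → V) (i j : ι) : replacePair B e i j i = e i + e j := by
  simp [replacePair]

omit [CharZero F] [Fintype ι] in
theorem replacePair_right (e : ι → V) {i j : ι} (hij : i ≠ j) :
    replacePair B e i j j = B (e j) (e j) • e i - B (e i) (e i) • e j := by
  simp [replacePair, hij.symm]

omit [CharZero F] [Fintype ι] in
theorem replacePair_of_ne (e : ι → V) {i j k : ι} (hi : k ≠ i) (hj : k ≠ j) :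
    replacePair B e i j k = e k := by
  simp [replacePair, hi, hj]

section replacePair

variable {e : ι → V} (he : IsOrthogonalFamily B e) {i j : ι} (hij : i ≠ j)
include he hij

omit [CharZero F] [Fintype ι] in
omit [CharZero F] [Fintype ι] in
theorem apply_replacePair_left :
    B (replacePair B e i j i) (replacePair B e i j i) = B (e i) (e i) + B (e j) (e j) := by
  simp [replacePair_left, he.ortho i j hij, he.ortho j i hij.symm]

omit [CharZero F] [Fintype ι] in
omit [CharZero F] [Fintype ι] in
theorem apply_replacePair_right :
    B (replacePair B e i j j) (replacePair B e i j j)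
      = B (e i) (e i) * B (e j) (e j) * (B (e i) (e i) + B (e j) (e j)) := by
  simp [replacePair_right e hij, he.ortho i j hij, he.ortho j i hij.symm]
  ring

include hB

omit [CharZero F] [Fintype ι] in
theorem IsOrthogonalFamily.replacePair (h : B (e i) (e i) + B (e j) (e j) ≠ 0) :
    IsOrthogonalFamily B (replacePair B e i j) := by
  have hlr : B (OrthogonalForms.replacePair B e i j i) (OrthogonalForms.replacePair B e i j j)
      = 0 := by
    simp [replacePair_left, replacePair_right e hij, he.ortho i j hij, he.ortho j i hij.symm]
    ring
  have hl : ∀ k, k ≠ i → k ≠ j →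
      B (e k) (OrthogonalForms.replacePair B e i j i) = 0 := by
    intro k hki hkj
    simp [replacePair_left, he.ortho k i hki, he.ortho k j hkj]
  have hr : ∀ k, k ≠ i → k ≠ j →
      B (e k) (OrthogonalForms.replacePair B e i j j) = 0 := by
    intro k hki hkj
    simp [replacePair_right e hij, he.ortho k i hki, he.ortho k j hkj]
  constructor
  · intro k l hkl
    by_cases hki : k = i
    · subst hki
      by_cases hlj : l = j
      · rw [hlj, hlr]
      · rw [replacePair_of_ne e hkl.symm hlj, hB, hl l hkl.symm hlj]
    by_cases hkj : k = j
    · subst hkj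
      by_cases hli : l = i
      · rw [hli, hB, hlr]
      · rw [replacePair_of_ne e hli hkl.symm, hB, hr l hli hkl.symm]
    rw [replacePair_of_ne e hki hkj]
    by_cases hli : l = i
    · rw [hli, hl k hki hkj]
    by_cases hlj : l = j
    · rw [hlj, hr k hki hkj]
    rw [replacePair_of_ne e hli hlj, he.ortho k l hkl]
  · intro k
    by_cases hki : k = i
    · rw [hki, apply_replacePair_left he hij]
      exact h
    by_cases hkj : k = j
    · rw [hkj, apply_replacePair_right he hij]
      exact mul_ne_zero (mul_ne_zero (he.aniso i) (he.aniso j)) h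
    rw [replacePair_of_ne e hki hkj]
    exact he.aniso k

omit hB

omit he [CharZero F] [Fintype ι] in
theorem span_range_replacePair (h : B (e i) (e i) + B (e j) (e j) ≠ 0) :
    Submodule.span F (Set.range (replacePair B e i j)) = Submodule.span F (Set.range e) := by
  have hmem : ∀ k, e k ∈ Submodule.span F (Set.range e) := fun k =>
    Submodule.subset_span ⟨k, rfl⟩
  have hmem' : ∀ k, replacePair B e i j k ∈ Submodule.span F (Set.range (replacePair B e i j)) :=
    fun k => Submodule.subset_span ⟨k, rfl⟩
  apply le_antisymm <;> rw [Submodule.span_le] <;> rintro _ ⟨k, rfl⟩ <;> rw [SetLike.mem_coe]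
  · unfold replacePair
    split_ifs
    · exact add_mem (hmem i) (hmem j)
    · exact sub_mem (Submodule.smul_mem _ _ (hmem i)) (Submodule.smul_mem _ _ (hmem j))
    · exact hmem k
  · have hl := hmem' i
    have hr := hmem' j
    rw [replacePair_left] at hl
    rw [replacePair_right e hij] at hr
    by_cases hki : k = i
    · have : e k = (B (e i) (e i) + B (e j) (e j))⁻¹ • (B (e i) (e i) • (e i + e j)
          + (B (e j) (e j) • e i - B (e i) (e i) • e j)) := by
        rw [eq_inv_smul_iff₀ h, hki]
        module
      rw [this]
      exact Submodule.smul_mem _ _ (add_mem (Submodule.smul_mem _ _ hl) hr)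
    by_cases hkj : k = j
    · have : e k = (B (e i) (e i) + B (e j) (e j))⁻¹ • (B (e j) (e j) • (e i + e j)
          - (B (e j) (e j) • e i - B (e i) (e i) • e j)) := by
        rw [eq_inv_smul_iff₀ h, hkj]
        module
      rw [this]
      exact Submodule.smul_mem _ _ (sub_mem (Submodule.smul_mem _ _ hl) hr)
    have := hmem' k
    rwa [replacePair_of_ne e hki hkj] at this

omit [CharZero F] in
include hε in
theorem prod_replacePair (h : B (e i) (e i) + B (e j) (e j) ≠ 0) :
    ∏ k, ε (B (replacePair B e i j k) (replacePair B e i j k)) = ∏ k, ε (B (e k) (e k)) := by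
  have hj : j ∈ Finset.univ.erase i := Finset.mem_erase.mpr ⟨hij.symm, Finset.mem_univ j⟩
  rw [← Finset.mul_prod_erase _ _ (Finset.mem_univ i), ← Finset.mul_prod_erase _ _ hj,
    ← Finset.mul_prod_erase (Finset.univ) (fun k => ε (B (e k) (e k))) (Finset.mem_univ i),
    ← Finset.mul_prod_erase _ (fun k => ε (B (e k) (e k))) hj, ← mul_assoc, ← mul_assoc,
    apply_replacePair_left he hij, apply_replacePair_right he hij,
    ← hε.binary _ _ (he.aniso i) (he.aniso j) h]
  congr 1
  refine Finset.prod_congr rfl fun k hk => ?_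
  have hkj := (Finset.mem_erase.mp hk).1
  have hki := (Finset.mem_erase.mp (Finset.mem_erase.mp hk).2).1
  rw [replacePair_of_ne e hki hkj]

end replacePair

-- Induction on the number of summands: two summands whose values do not cancel are merged into one
-- vector, and their orthogonal partner drops out of the sum. Each merge changes only a binary
-- subform, so the product is kept.
include hB hε in
theorem exists_isOrthogonalFamily_of_sum (s : Finset ι) :
    ∀ e : ι → V, IsOrthogonalFamily B e → B (∑ i ∈ s, e i) (∑ i ∈ s, e i) ≠ 0 →
      ∃ e' : ι → V, IsOrthogonalFamily B e' ∧
        Submodule.span F (Set.range e') = Submodule.span F (Set.range e) ∧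
        ∏ k, ε (B (e' k) (e' k)) = ∏ k, ε (B (e k) (e k)) ∧ ∃ i, e' i = ∑ i ∈ s, e i := by
  induction s using Finset.strongInduction with
  | H s ih =>
    intro e he hs
    rcases Nat.lt_trichotomy s.card 1 with hc | hc | hc
    · rw [Nat.lt_one_iff, Finset.card_eq_zero] at hc
      simp [hc] at hs
    · obtain ⟨i, rfl⟩ := Finset.card_eq_one.mp hc
      exact ⟨e, he, rfl, rfl, i, by simp⟩
    · rw [he.apply_sum_self] at hs
      obtain ⟨i, hi, j, hj, hij, h⟩ := exists_pair_add_ne_zero he.aniso hc hs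
      have hsum : ∑ k ∈ s.erase j, replacePair B e i j k = ∑ k ∈ s, e k := by
        have hi' : i ∈ s.erase j := Finset.mem_erase.mpr ⟨hij, hi⟩
        rw [← Finset.add_sum_erase _ _ hi', ← Finset.add_sum_erase s _ hj,
          ← Finset.add_sum_erase (s.erase j) e hi', replacePair_left, ← add_assoc,
          add_comm (e i)]
        congr 1
        refine Finset.sum_congr rfl fun k hk => ?_
        have hki := (Finset.mem_erase.mp hk).1
        have hkj := (Finset.mem_erase.mp (Finset.mem_erase.mp hk).2).1
        rw [replacePair_of_ne e hki hkj]
      obtain ⟨e', he', hspan, hprod, hl⟩ := ih (s.erase j) (Finset.erase_ssubset hj)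
        (replacePair B e i j) (he.replacePair hB hij h) (by
          rwa [hsum, he.apply_sum_self])
      refine ⟨e', he', hspan.trans (span_range_replacePair hij h),
        hprod.trans (prod_replacePair hε he hij h), ?_⟩
      rwa [hsum] at hl

include hB hε in
theorem exists_isOrthogonalFamily_of_mem_span {e : ι → V} (he : IsOrthogonalFamily B e) {v : V}
    (hv : v ∈ Submodule.span F (Set.range e)) (hvv : B v v ≠ 0) :
    ∃ e' : ι → V, IsOrthogonalFamily B e' ∧
      Submodule.span F (Set.range e') = Submodule.span F (Set.range e) ∧
      ∏ k, ε (B (e' k) (e' k)) = ∏ k, ε (B (e k) (e k)) ∧ ∃ i, e' i = v := by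
  classical
  obtain ⟨x, hx⟩ := (Submodule.mem_span_range_iff_exists_fun F).mp hv
  -- Rescaling makes v a sum over a subset of the family. Vectors with coefficient 0 keep scale 1,
  -- so that they stay anisotropic, and are left out of the subset.
  let c : ι → F := fun i => if x i = 0 then 1 else x i
  have hc : ∀ i, c i ≠ 0 := by
    intro i
    simp only [c]
    split_ifs with h
    exacts [one_ne_zero, h]
  let e₁ : ι → V := fun i => c i • e i
  have hval : ∀ i, B (e₁ i) (e₁ i) = B (e i) (e i) * c i ^ 2 := by
    intro i
    simp [e₁]
    ring
  have he₁ : IsOrthogonalFamily B e₁ := by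
    refine ⟨fun i j hij => by simp [e₁, he.ortho i j hij], fun i => ?_⟩
    rw [hval]
    exact mul_ne_zero (he.aniso i) (pow_ne_zero 2 (hc i))
  have hspan : Submodule.span F (Set.range e₁) = Submodule.span F (Set.range e) := by
    apply le_antisymm <;> rw [Submodule.span_le] <;> rintro _ ⟨k, rfl⟩ <;> rw [SetLike.mem_coe]
    · exact Submodule.smul_mem _ _ (Submodule.subset_span ⟨k, rfl⟩)
    · have : e k = (c k)⁻¹ • e₁ k := by simp [e₁, smul_smul, hc k]
      rw [this]
      exact Submodule.smul_mem _ _ (Submodule.subset_span ⟨k, rfl⟩)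
  have hsum : ∑ i ∈ Finset.univ.filter (fun i => x i ≠ 0), e₁ i = v := by
    rw [← hx, Finset.sum_filter]
    refine Finset.sum_congr rfl fun i _ => ?_
    by_cases h : x i = 0 <;> simp [e₁, c, h]
  obtain ⟨e', he', h1, h2, h3⟩ := exists_isOrthogonalFamily_of_sum hB hε _ e₁ he₁
    (by rwa [hsum])
  refine ⟨e', he', h1.trans hspan, h2.trans ?_, by rwa [hsum] at h3⟩
  refine Finset.prod_congr rfl fun i _ => ?_
  rw [hval, hε.mul_sq _ _ (he.aniso i) (hc i)]

-- The span of the tail is the orthogonal complement of the first vector, so it depends only on that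
-- vector and the whole span. This lets the induction on rank compare tails without Witt
-- cancellation.
omit [CharZero F] in
theorem IsOrthogonalFamily.mem_span_tail_iff {e : Fin (n + 1) → V} (he : IsOrthogonalFamily B e)
    (w : V) : w ∈ Submodule.span F (Set.range (Fin.tail e)) ↔
      w ∈ Submodule.span F (Set.range e) ∧ B (e 0) w = 0 := by
  have h0 : ∀ z ∈ Submodule.span F (Set.range (Fin.tail e)), B (e 0) z = 0 := by
    intro z hz
    have : Submodule.span F (Set.range (Fin.tail e)) ≤ LinearMap.ker (B (e 0)) := by
      rw [Submodule.span_le]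
      rintro _ ⟨k, rfl⟩
      exact he.ortho 0 k.succ (Fin.succ_ne_zero k).symm
    exact this hz
  have hr : Set.range e = insert (e 0) (Set.range (Fin.tail e)) := Fin.range_fin_succ e
  constructor
  · intro hw
    refine ⟨Submodule.span_mono ?_ hw, h0 w hw⟩
    rw [hr]
    exact Set.subset_insert _ _
  · rintro ⟨hw, hw0⟩
    rw [hr, Submodule.mem_span_insert] at hw
    obtain ⟨a, z, hz, rfl⟩ := hw
    rw [map_add, map_smul, h0 z hz, add_zero, smul_eq_mul] at hw0
    rcases mul_eq_zero.mp hw0 with h | h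
    · simpa [h] using hz
    · exact absurd h (he.aniso 0)

-- Move the first family, without changing its product, to one that contains f 0; permute f 0 to the
-- front; then the tails span the same complement and induction applies.
include hB hε in
theorem prod_eq_prod_of_span_eq (e f : Fin n → V) (he : IsOrthogonalFamily B e)
    (hf : IsOrthogonalFamily B f)
    (h : Submodule.span F (Set.range e) = Submodule.span F (Set.range f)) :
    ∏ i, ε (B (e i) (e i)) = ∏ i, ε (B (f i) (f i)) := by
  induction n with
  | zero => simp
  | succ n ih =>
    obtain ⟨e', he', hspan, hprod, i, hi⟩ := exists_isOrthogonalFamily_of_mem_span hB hε he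
      (v := f 0) (by rw [h]; exact Submodule.subset_span ⟨0, rfl⟩) (hf.aniso 0)
    let σ := Equiv.swap 0 i
    have hσ0 : (e' ∘ σ) 0 = f 0 := by simp [σ, hi]
    have hσ : IsOrthogonalFamily B (e' ∘ σ) :=
      ⟨fun k l hkl => he'.ortho _ _ (σ.injective.ne hkl), fun k => he'.aniso _⟩
    have hσs : Submodule.span F (Set.range (e' ∘ σ)) = Submodule.span F (Set.range f) := by
      rw [EquivLike.range_comp, hspan, h]
    have htail := ih (Fin.tail (e' ∘ σ)) (Fin.tail f)
      ⟨fun k l hkl => hσ.ortho _ _ (by simpa using hkl), fun k => hσ.aniso _⟩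
      ⟨fun k l hkl => hf.ortho _ _ (by simpa using hkl), fun k => hf.aniso _⟩ (by
        ext w
        rw [hσ.mem_span_tail_iff, hf.mem_span_tail_iff, hσs, hσ0])
    rw [← hprod, ← Equiv.prod_comp σ, Fin.prod_univ_succ, Fin.prod_univ_succ]
    change ε (B ((e' ∘ σ) 0) ((e' ∘ σ) 0)) * _ = _
    rw [hσ0]
    congr 1

omit [CharZero F] in
theorem weightedSumSquares_single_add (d : ι → F) {i j : ι} (hij : i ≠ j) :
    QuadraticMap.weightedSumSquares F d (Pi.single i 1 + Pi.single j 1) = d i + d j := by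
  rw [QuadraticMap.weightedSumSquares_apply]
  simp only [Pi.add_apply, smul_eq_mul]
  rw [← Finset.sum_subset (Finset.subset_univ {i, j}), Finset.sum_pair hij]
  · simp [hij, hij.symm]
  · intro k _ hk
    simp only [Finset.mem_insert, Finset.mem_singleton, not_or] at hk
    simp [hk.1, hk.2]

omit [CharZero F] in
theorem weightedSumSquares_single (d : ι → F) (i : ι) :
    QuadraticMap.weightedSumSquares F d (Pi.single i 1) = d i := by
  rw [QuadraticMap.weightedSumSquares_apply, Finset.sum_eq_single i] <;>
    simp +contextual

theorem isOrthogonalFamily_of_isometryEquiv {q : QuadraticForm F V} {d : ι → F}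
    (hd : ∀ i, d i ≠ 0) (T : q.IsometryEquiv (QuadraticMap.weightedSumSquares F d)) :
    IsOrthogonalFamily (QuadraticMap.associated q) (fun i => T.symm (Pi.single i 1)) ∧
    Submodule.span F (Set.range fun i => T.symm (Pi.single i (1 : F))) = ⊤ ∧
    ∀ i, QuadraticMap.associated q (T.symm (Pi.single i 1)) (T.symm (Pi.single i 1)) = d i := by
  have hq : ∀ x, q (T.symm x) = QuadraticMap.weightedSumSquares F d x := fun x =>
    T.symm.map_app x
  have hv : ∀ i, QuadraticMap.associated q (T.symm (Pi.single i 1)) (T.symm (Pi.single i 1))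
      = d i := by
    intro i
    rw [QuadraticMap.associated_eq_self_apply, hq, weightedSumSquares_single]
  refine ⟨⟨fun i j hij => ?_, fun i => ?_⟩, ?_, hv⟩
  · have hadd : T.symm (Pi.single i 1) + T.symm (Pi.single j 1)
        = T.symm (Pi.single i 1 + Pi.single j 1) := (map_add T.symm.toLinearEquiv _ _).symm
    rw [QuadraticMap.associated_apply, hadd, hq, hq, hq, weightedSumSquares_single_add d hij,
      weightedSumSquares_single, weightedSumSquares_single]
    simp
  · rw [hv]
    exact hd i
  · have := (Pi.basisFun F ι).map T.symm.toLinearEquiv |>.span_eq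
    rw [← this]
    congr 2
    ext i
    simp

/-- A function on `F` that respects the Grothendieck–Witt relations yields an invariant of diagonal
quadratic forms. -/
theorem IsWittInvariant.prod_eq_prod (hε : IsWittInvariant ε) {d d' : Fin n → F}
    (hd : ∀ i, d i ≠ 0) (hd' : ∀ i, d' i ≠ 0)
    (h : (QuadraticMap.weightedSumSquares F d).Equivalent (QuadraticMap.weightedSumSquares F d')) :
    ∏ i, ε (d i) = ∏ i, ε (d' i) := by
  obtain ⟨T⟩ := h
  obtain ⟨he, hes, hev⟩ := isOrthogonalFamily_of_isometryEquiv hd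
    (QuadraticMap.IsometryEquiv.refl (QuadraticMap.weightedSumSquares F d))
  obtain ⟨hf, hfs, hfv⟩ := isOrthogonalFamily_of_isometryEquiv hd' T
  have := prod_eq_prod_of_span_eq (QuadraticMap.associated_isSymm F _) hε _ _ he hf (hes.trans hfs.symm)
  simpa only [hev, hfv] using this

end Witt

/-! ### Values of binary norm forms -/

/-- `a` is of the form `u² - b v²`, that is, a norm from `F(√b)` when `b` is not a square. -/
def IsNormValue {F : Type*} [Field F] (b a : F) : Prop :=
  ∃ u v, a = u ^ 2 - b * v ^ 2

section IsNormValue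

variable {F : Type*} [Field F] {a a' b c : F}

theorem IsNormValue.mul (h : IsNormValue b a) (h' : IsNormValue b a') :
    IsNormValue b (a * a') := by
  obtain ⟨u, v, rfl⟩ := h
  obtain ⟨u', v', rfl⟩ := h'
  exact ⟨u * u' + b * v * v', u * v' + v * u', by ring⟩

theorem isNormValue_sq (b c : F) : IsNormValue b (c ^ 2) := ⟨c, 0, by ring⟩

theorem isNormValue_neg_self (b : F) : IsNormValue b (-b) := ⟨0, 1, by ring⟩

theorem isNormValue_mul_sq_iff (hc : c ≠ 0) : IsNormValue b (a * c ^ 2) ↔ IsNormValue b a := by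
  refine ⟨fun h => ?_, fun h => h.mul (isNormValue_sq b c)⟩
  have := h.mul (isNormValue_sq b c⁻¹)
  rwa [mul_assoc, ← mul_pow, mul_inv_cancel₀ hc, one_pow, mul_one] at this

theorem isNormValue_right_mul_sq_iff (hc : c ≠ 0) :
    IsNormValue (b * c ^ 2) a ↔ IsNormValue b a := by
  constructor
  · rintro ⟨u, v, rfl⟩
    exact ⟨u, c * v, by ring⟩
  · rintro ⟨u, v, rfl⟩
    exact ⟨u, v / c, by field_simp⟩

theorem isNormValue_of_mul_left (ha' : IsNormValue b a') (h0 : a' ≠ 0)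
    (h : IsNormValue b (a' * a)) : IsNormValue b a := by
  have := ha'.mul h
  rw [show a' * (a' * a) = a * a' ^ 2 by ring] at this
  exact (isNormValue_mul_sq_iff h0).mp this

end IsNormValue

/-! ### Index of the norm values: odd primes -/

section Padic

variable {p : ℕ} [hp : Fact p.Prime]

theorem isSquare_of_norm_lt {u w : ℤ_[p]} (h : ‖w ^ 2 - u‖ < ‖2 * w‖ ^ 2) : ∃ s, u = s ^ 2 := by
  obtain ⟨z, hz, -⟩ := hensels_lemma (p := p) (R := ℤ_[p])
    (F := (Polynomial.X ^ 2 - Polynomial.C u)) (a := w) (by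
      simpa [one_add_one_eq_two] using h)
  exact ⟨z, by simpa [sub_eq_zero, eq_comm] using hz⟩

theorem exists_eq_unit_mul_sq {a : ℚ_[p]} (ha : a ≠ 0) :
    ∃ u : ℤ_[p], ‖u‖ = 1 ∧ ∃ c : ℚ_[p], c ≠ 0 ∧ (a = u * c ^ 2 ∨ a = p * u * c ^ 2) := by
  have hp0 : (p : ℚ_[p]) ≠ 0 := by exact_mod_cast hp.out.ne_zero
  have hnorm : ‖a * (p : ℚ_[p]) ^ (-a.valuation)‖ = 1 := by
    rw [norm_mul, Padic.norm_p_zpow, Padic.norm_eq_zpow_neg_valuation ha, ← zpow_add₀]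
    · simp
    · exact_mod_cast hp.out.ne_zero
  refine ⟨⟨_, hnorm.le⟩, hnorm, ?_⟩
  obtain ⟨k, hk | hk⟩ := Int.even_or_odd' a.valuation
  · refine ⟨(p : ℚ_[p]) ^ k, zpow_ne_zero _ hp0, Or.inl ?_⟩
    change a = a * _ * _
    rw [mul_assoc, ← zpow_natCast, ← _root_.zpow_mul, ← zpow_add₀ hp0, hk]
    simp [mul_comm k]
  · refine ⟨(p : ℚ_[p]) ^ k, zpow_ne_zero _ hp0, Or.inr ?_⟩
    change a = p * (a * _) * _
    rw [mul_comm (p : ℚ_[p]), mul_assoc, mul_assoc, ← zpow_natCast, ← _root_.zpow_mul, ← zpow_one_add₀ hp0,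
      ← zpow_add₀ hp0, hk, show -(2 * k + 1) + (1 + k * ((2 : ℕ) : ℤ)) = 0 by push_cast; ring,
      zpow_zero, mul_one]

theorem toZMod_eq_zero_iff (x : ℤ_[p]) : PadicInt.toZMod x = 0 ↔ ‖x‖ < 1 := by
  rw [← RingHom.mem_ker, PadicInt.ker_toZMod, IsLocalRing.mem_maximalIdeal, PadicInt.mem_nonunits]

theorem toZMod_ne_zero_iff (x : ℤ_[p]) : PadicInt.toZMod x ≠ 0 ↔ ‖x‖ = 1 := by
  rw [Ne, toZMod_eq_zero_iff, not_lt]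
  exact ⟨fun h => le_antisymm x.norm_le_one h, fun h => h.ge⟩

theorem toZMod_surjective : Function.Surjective (PadicInt.toZMod : ℤ_[p] →+* ZMod p) :=
  ZMod.ringHom_surjective _

theorem norm_two_eq_one (h2 : p ≠ 2) : ‖(2 : ℤ_[p])‖ = 1 := by
  rw [← toZMod_ne_zero_iff, map_ofNat]
  have := (ZMod.natCast_eq_zero_iff 2 p).not.mpr
    (fun h => h2 ((Nat.prime_dvd_prime_iff_eq hp.out Nat.prime_two).mp h))
  exact_mod_cast this

theorem exists_eq_sq_of_toZMod (h2 : p ≠ 2) {u : ℤ_[p]} {x : ZMod p} (hx : x ≠ 0)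
    (h : PadicInt.toZMod u = x ^ 2) : ∃ s, u = s ^ 2 := by
  obtain ⟨w, rfl⟩ := toZMod_surjective x
  refine isSquare_of_norm_lt (w := w) ?_
  rw [norm_mul, norm_two_eq_one h2, (toZMod_ne_zero_iff w).mp hx, mul_one, one_pow,
    ← toZMod_eq_zero_iff, map_sub, map_pow, h, sub_self]

/-- A counting argument solves u = x² - b y² modulo p. One of x, y is non-zero there, and Hensel's
lemma lifts that coordinate. -/
theorem isNormValue_unit (h2 : p ≠ 2) {u b : ℤ_[p]} (hu : ‖u‖ = 1) (hb : ‖b‖ = 1) :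
    IsNormValue (b : ℚ_[p]) (u : ℚ_[p]) := by
  have hb' := (toZMod_ne_zero_iff b).mpr hb
  have hu' := (toZMod_ne_zero_iff u).mpr hu
  obtain ⟨x, y, hxy⟩ : ∃ x y : ZMod p, PadicInt.toZMod u = x ^ 2 - PadicInt.toZMod b * y ^ 2 := by
    obtain ⟨x, y, hxy⟩ := FiniteField.exists_root_sum_quadratic
      (f := Polynomial.X ^ 2 - Polynomial.C (PadicInt.toZMod u))
      (g := Polynomial.C (-PadicInt.toZMod b) * Polynomial.X ^ 2)
      (Polynomial.degree_X_pow_sub_C two_pos _)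
      (Polynomial.degree_C_mul_X_pow 2 (neg_ne_zero.mpr hb')) (by
        rw [ZMod.card]
        exact Nat.odd_iff.mp (hp.out.odd_of_ne_two h2))
    refine ⟨x, y, ?_⟩
    simp only [Polynomial.eval_sub, Polynomial.eval_mul, Polynomial.eval_pow, Polynomial.eval_X,
      Polynomial.eval_C] at hxy
    linear_combination -hxy
  by_cases hx : x = 0
  · have hy : y ≠ 0 := by
      rintro rfl
      apply hu'
      rw [hxy, hx]
      ring
    obtain ⟨b', hb'1⟩ := (PadicInt.isUnit_iff.mpr hb).exists_right_inv
    obtain ⟨s, hs⟩ := exists_eq_sq_of_toZMod h2 (u := -(b' * u)) hy (by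
      have := congrArg PadicInt.toZMod hb'1
      rw [map_mul, map_one] at this
      rw [map_neg, map_mul, hxy, hx]
      linear_combination (y ^ 2) * this)
    refine ⟨0, s, ?_⟩
    have : u = -(b * s ^ 2) := by linear_combination -(b * hs) - u * hb'1
    rw [this]
    push_cast
    ring
  · obtain ⟨y, rfl⟩ := toZMod_surjective y
    obtain ⟨s, hs⟩ := exists_eq_sq_of_toZMod h2 (u := u + b * y ^ 2) hx (by
      rw [map_add, map_mul, map_pow, hxy]
      ring)
    refine ⟨s, y, ?_⟩
    have : u = s ^ 2 - b * y ^ 2 := by linear_combination hs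
    rw [this]
    push_cast
    ring

/-- The values of the norm form of `ℚ_p(√b)` have index at most two, `p` odd. -/
theorem exists_isNormValue_or_mul_of_ne_two (h2 : p ≠ 2) {b : ℚ_[p]} (hb : b ≠ 0) :
    ∃ r : ℚ_[p], r ≠ 0 ∧ ∀ a, a ≠ 0 → IsNormValue b a ∨ IsNormValue b (r * a) := by
  have hp0 : (p : ℚ_[p]) ≠ 0 := by exact_mod_cast hp.out.ne_zero
  obtain ⟨b₀, hb₀, c, hc, hbc | hbc⟩ := exists_eq_unit_mul_sq hb
  -- Up to squares b is a unit. Then all units are norm values, and multiplication by p handles odd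
  -- valuation.
  · refine ⟨p, hp0, fun a ha => ?_⟩
    obtain ⟨u, hu, d, hd, rfl | rfl⟩ := exists_eq_unit_mul_sq ha
    · left
      rw [hbc, isNormValue_right_mul_sq_iff hc, isNormValue_mul_sq_iff hd]
      exact isNormValue_unit h2 hu hb₀
    · right
      rw [show (p : ℚ_[p]) * (p * u * d ^ 2) = u * (p * d) ^ 2 by ring, hbc,
        isNormValue_right_mul_sq_iff hc, isNormValue_mul_sq_iff (mul_ne_zero hp0 hd)]
      exact isNormValue_unit h2 hu hb₀
  -- Up to squares b is p times a unit. Now a lifted non-residue r represents the non-trivial class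
  -- of units modulo squares, and the norm value -b carries odd valuation to even.
  · obtain ⟨x, hx⟩ := FiniteField.exists_nonsquare (F := ZMod p) (by
      rwa [ZMod.ringChar_zmod_n])
    obtain ⟨r, rfl⟩ := toZMod_surjective x
    have hr0 : PadicInt.toZMod r ≠ 0 := fun h => hx (by rw [h]; exact IsSquare.zero)
    have hr : r ≠ 0 := by
      rintro rfl
      simp at hr0
    have key : ∀ (u : ℤ_[p]) (d : ℚ_[p]), ‖u‖ = 1 →
        IsNormValue b (u * d ^ 2) ∨ IsNormValue b (r * (u * d ^ 2)) := by
      intro u d hu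
      have hu0 := (toZMod_ne_zero_iff u).mpr hu
      by_cases hs : IsSquare (PadicInt.toZMod u)
      · left
        obtain ⟨y, hy⟩ := hs
        obtain ⟨s, rfl⟩ := exists_eq_sq_of_toZMod h2 (u := u) (x := y)
          (by rintro rfl; simp [hy] at hu0) (by rw [hy]; ring)
        rw [PadicInt.coe_pow, ← mul_pow]
        exact isNormValue_sq _ _
      · right
        have h2' : ringChar (ZMod p) ≠ 2 := by rwa [ZMod.ringChar_zmod_n]
        have hmul : IsSquare (PadicInt.toZMod (r * u)) := by
          rw [map_mul, ← quadraticChar_one_iff_isSquare (mul_ne_zero hr0 hu0), map_mul,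
            quadraticChar_neg_one_iff_not_isSquare.mpr hx,
            quadraticChar_neg_one_iff_not_isSquare.mpr hs]
          norm_num
        obtain ⟨y, hy⟩ := hmul
        obtain ⟨s, hs⟩ := exists_eq_sq_of_toZMod h2 (u := r * u) (x := y)
          (by rintro rfl; simp [hr0, hu0] at hy) (by rw [hy]; ring)
        have hs' : (r : ℚ_[p]) * u = s ^ 2 := by exact_mod_cast congrArg PadicInt.Coe.ringHom hs
        rw [← mul_assoc, hs', ← mul_pow]
        exact isNormValue_sq _ _
    refine ⟨r, by rwa [Ne, PadicInt.coe_eq_zero], fun a ha => ?_⟩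
    obtain ⟨u, hu, d, hd, rfl | rfl⟩ := exists_eq_unit_mul_sq ha
    · exact key u d hu
    · have hnu : ‖-(b₀ * u)‖ = 1 := by rw [norm_neg, norm_mul, hu, hb₀, one_mul]
      have e : -b * (p * u * d ^ 2) = (-(b₀ * u) : ℤ_[p]) * (p * c * d) ^ 2 := by
        rw [hbc]
        push_cast
        ring
      have hk := key _ (p * c * d) hnu
      rw [← e] at hk
      rcases hk with h | h
      · exact Or.inl (isNormValue_of_mul_left (isNormValue_neg_self b) (neg_ne_zero.mpr hb) h)
      · right
        rw [mul_left_comm] at h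
        exact isNormValue_of_mul_left (isNormValue_neg_self b) (neg_ne_zero.mpr hb) h

end Padic

/-! ### Index of the norm values: the prime two -/

section TwoAdic

theorem exists_eq_sq_of_toZModPow_eq_one {u : ℤ_[2]} (h : PadicInt.toZModPow 3 u = 1) :
    ∃ s, u = s ^ 2 := by
  -- Hensel's lemma at 1 needs |1 - u| < |2|² = 1/4, and u ≡ 1 mod 8 gives 1/8.
  refine isSquare_of_norm_lt (w := 1) ?_
  have h1 : (1 ^ 2 - u) ∈ RingHom.ker (PadicInt.toZModPow (p := 2) 3) := by
    rw [RingHom.mem_ker, map_sub, h]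
    simp
  rw [PadicInt.ker_toZModPow, ← PadicInt.norm_le_pow_iff_mem_span_pow] at h1
  refine h1.trans_lt ?_
  have : ‖(2 : ℤ_[2])‖ = 2⁻¹ := by simpa using PadicInt.norm_p (p := 2)
  rw [mul_one, this]
  norm_num

/-- The cases are 1, 4 and 16 times an integer that is 1 modulo 8. -/
theorem exists_int_eq_sq {m : ℤ} (hm : m % 8 = 1 ∨ m % 32 = 4 ∨ m % 128 = 16) :
    ∃ s : ℚ_[2], s ≠ 0 ∧ (m : ℚ_[2]) = s ^ 2 := by
  have base : ∀ k : ℤ, k % 8 = 1 → ∃ s : ℚ_[2], (k : ℚ_[2]) = s ^ 2 := by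
    intro k hk
    obtain ⟨s, hs⟩ := exists_eq_sq_of_toZModPow_eq_one (u := (k : ℤ_[2])) (by
      rw [map_intCast, ← Int.cast_one, ZMod.intCast_eq_intCast_iff]
      exact hk)
    exact ⟨s, by exact_mod_cast congrArg PadicInt.Coe.ringHom hs⟩
  have hm0 : (m : ℚ_[2]) ≠ 0 := by
    have : m ≠ 0 := by omega
    exact_mod_cast this
  suffices h : ∃ s : ℚ_[2], (m : ℚ_[2]) = s ^ 2 by
    obtain ⟨s, hs⟩ := h
    refine ⟨s, ?_, hs⟩
    rintro rfl
    simp at hs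
    exact hm0 (by exact_mod_cast hs)
  rcases hm with h | h | h
  · exact base m h
  · obtain ⟨s, hs⟩ := base (m / 4) (by omega)
    have : m = 4 * (m / 4) := by omega
    refine ⟨2 * s, ?_⟩
    rw [this, Int.cast_mul, hs]
    push_cast
    ring
  · obtain ⟨s, hs⟩ := base (m / 16) (by omega)
    have : m = 16 * (m / 16) := by omega
    refine ⟨4 * s, ?_⟩
    rw [this, Int.cast_mul, hs]
    push_cast
    ring

/-- Representatives of the non-zero elements of `ℚ_2` modulo squares. -/
def twoAdicSquareClasses : List ℤ := [1, 3, 5, 7, 2, 6, 10, 14]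

theorem exists_mem_twoAdicSquareClasses {a : ℚ_[2]} (ha : a ≠ 0) :
    ∃ m ∈ twoAdicSquareClasses, ∃ c : ℚ_[2], c ≠ 0 ∧ a = m * c ^ 2 := by
  have hunit : ∀ u : ℤ_[2], ‖u‖ = 1 → ∃ m ∈ ([1, 3, 5, 7] : List ℤ), ∃ s : ℚ_[2], s ≠ 0 ∧
      (u : ℚ_[2]) = m * s ^ 2 := by
    intro u hu
    have hr : IsUnit (PadicInt.toZModPow 3 u) := (PadicInt.isUnit_iff.mpr hu).map _
    -- Take m inverse to u modulo 8: then m u is a square s², and u = m (s/m)².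
    obtain ⟨m, hm, hm1⟩ : ∃ m ∈ ([1, 3, 5, 7] : List ℤ),
        (m : ZMod (2 ^ 3)) * PadicInt.toZModPow 3 u = 1 := by
      revert hr
      generalize PadicInt.toZModPow 3 u = r
      revert r
      decide
    obtain ⟨s, hs⟩ := exists_eq_sq_of_toZModPow_eq_one (u := m * u) (by
      rw [map_mul, map_intCast, hm1])
    have hs' : (m : ℚ_[2]) * u = s ^ 2 := by exact_mod_cast congrArg PadicInt.Coe.ringHom hs
    have hm0 : (m : ℚ_[2]) ≠ 0 := by
      have : m ≠ 0 := by rintro rfl; simp at hm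
      exact_mod_cast this
    have hu0 : (u : ℚ_[2]) ≠ 0 := by
      intro h
      rw [PadicInt.coe_eq_zero] at h
      simp [h] at hu
    refine ⟨m, hm, s / m, div_ne_zero ?_ hm0, ?_⟩
    · intro h
      rw [h] at hs'
      simp [hm0, hu0] at hs'
    · field_simp
      linear_combination hs'
  obtain ⟨u, hu, c, hc, h⟩ := exists_eq_unit_mul_sq ha
  obtain ⟨m, hm, s, hs, hus⟩ := hunit u hu
  rcases h with rfl | rfl
  · refine ⟨m, ?_, s * c, mul_ne_zero hs hc, by rw [hus]; ring⟩
    clear hus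
    revert m
    decide
  · refine ⟨2 * m, ?_, s * c, mul_ne_zero hs hc, by rw [hus]; push_cast; ring⟩
    clear hus
    revert m
    decide

/-- A finite certificate for index at most two: for each square class a, one of a and r a becomes a
recognisable 2-adic square after multiplication by a small value of x² - b y², so it is itself a
norm value. -/
theorem exists_two_adic_coset : ∀ b ∈ twoAdicSquareClasses, ∃ r ∈ twoAdicSquareClasses,
    ∀ a ∈ twoAdicSquareClasses,
      ∃ a' ∈ [a, r * a], ∃ x ∈ ([0, 1, 2, 3] : List ℤ), ∃ y ∈ ([0, 1, 2, 3] : List ℤ),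
        (x ^ 2 - b * y ^ 2) * a' % 8 = 1 ∨ (x ^ 2 - b * y ^ 2) * a' % 32 = 4 ∨
          (x ^ 2 - b * y ^ 2) * a' % 128 = 16 := by
  decide

theorem exists_isNormValue_or_mul_two {b : ℚ_[2]} (hb : b ≠ 0) :
    ∃ r : ℚ_[2], r ≠ 0 ∧ ∀ a, a ≠ 0 → IsNormValue b a ∨ IsNormValue b (r * a) := by
  obtain ⟨m, hm, c, hc, rfl⟩ := exists_mem_twoAdicSquareClasses hb
  obtain ⟨r, hr, h⟩ := exists_two_adic_coset m hm
  have hr0 : r ≠ 0 := by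
    rintro rfl
    revert hr
    decide
  refine ⟨r, by exact_mod_cast hr0, fun a ha => ?_⟩
  obtain ⟨k, hk, d, hd, rfl⟩ := exists_mem_twoAdicSquareClasses ha
  obtain ⟨a', ha', x, -, y, -, hxy⟩ := h k hk
  have hN : IsNormValue (m : ℚ_[2]) a' := by
    obtain ⟨s, hs0, hs⟩ := exists_int_eq_sq hxy
    push_cast at hs
    have ha'0 : (a' : ℚ_[2]) ≠ 0 := by
      intro h0
      rw [h0, mul_zero] at hs
      exact hs0 (pow_eq_zero_iff two_ne_zero |>.mp hs.symm)
    -- From (x² - b y²) a' = s² one gets a' = (x² - b y²) (a'/s)².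
    refine ⟨x * (a' / s), y * (a' / s), ?_⟩
    field_simp
    linear_combination -hs
  simp only [List.mem_cons, List.not_mem_nil, or_false] at ha'
  rw [isNormValue_right_mul_sq_iff hc, isNormValue_right_mul_sq_iff hc, ← mul_assoc,
    isNormValue_mul_sq_iff hd, isNormValue_mul_sq_iff hd]
  rcases ha' with rfl | rfl
  · exact Or.inl hN
  · right
    exact_mod_cast hN

end TwoAdic

theorem exists_isNormValue_or_mul {p : ℕ} [hp : Fact p.Prime] {b : ℚ_[p]} (hb : b ≠ 0) :
    ∃ r : ℚ_[p], r ≠ 0 ∧ ∀ a, a ≠ 0 → IsNormValue b a ∨ IsNormValue b (r * a) := by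
  by_cases h2 : p = 2
  · subst h2
    exact exists_isNormValue_or_mul_two hb
  · exact exists_isNormValue_or_mul_of_ne_two h2 hb

/-! ### Bimultiplicativity of the Hilbert symbol -/

section HilbertSymbol

variable {p : ℕ} [hp : Fact p.Prime] {a a' b c : ℚ_[p]}

theorem hilbertSymbol_eq_one_iff (hb : b ≠ 0) :
    hilbertSymbol p a b = 1 ↔ IsNormValue b a := by
  have : hilbertSymbol p a b = 1 ↔
      ∃ x y z : ℚ_[p], (x, y, z) ≠ (0, 0, 0) ∧ a * x ^ 2 + b * y ^ 2 - z ^ 2 = 0 := by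
    unfold hilbertSymbol
    split_ifs with h
    · exact iff_of_true rfl h
    · exact iff_of_false (by norm_num) h
  rw [this]
  constructor
  · rintro ⟨x, y, z, h0, h⟩
    by_cases hx : x = 0
    · have hy : y ≠ 0 := by
        rintro rfl
        subst hx
        have : z = 0 := by simpa using h
        exact h0 (by rw [this])
      have hb' : b = 1 * (z / y) ^ 2 := by
        subst hx
        field_simp
        linear_combination h
      have hzy : z / y ≠ 0 := by
        intro h1
        rw [h1] at hb'
        exact hb (by simpa using hb')
      rw [hb', isNormValue_right_mul_sq_iff hzy]
      -- A zero with x = 0 forces b to be a square, and u² - v² represents everything.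
      exact ⟨(a + 1) / 2, (a - 1) / 2, by ring⟩
    · refine ⟨z / x, y / x, ?_⟩
      field_simp
      linear_combination h
  · rintro ⟨u, v, huv⟩
    exact ⟨1, v, u, by simp, by rw [huv]; ring⟩

theorem hilbertSymbol_eq_or (a b : ℚ_[p]) : hilbertSymbol p a b = 1 ∨ hilbertSymbol p a b = -1 := by
  unfold hilbertSymbol
  split_ifs <;> simp

theorem hilbertSymbol_mul_self (a b : ℚ_[p]) : hilbertSymbol p a b * hilbertSymbol p a b = 1 := by
  rcases hilbertSymbol_eq_or a b with h | h <;> simp [h]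

theorem hilbertSymbol_comm (a b : ℚ_[p]) : hilbertSymbol p a b = hilbertSymbol p b a := by
  have : ∀ a b : ℚ_[p], (∃ x y z : ℚ_[p], (x, y, z) ≠ (0, 0, 0) ∧
      a * x ^ 2 + b * y ^ 2 - z ^ 2 = 0) → ∃ x y z : ℚ_[p], (x, y, z) ≠ (0, 0, 0) ∧
      b * x ^ 2 + a * y ^ 2 - z ^ 2 = 0 := by
    rintro a b ⟨x, y, z, h0, h⟩
    refine ⟨y, x, z, fun h1 => h0 ?_, by linear_combination h⟩
    simp only [Prod.mk.injEq] at h1 ⊢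
    tauto
  unfold hilbertSymbol
  congr 1
  exact propext ⟨this a b, this b a⟩

/-- Non-zero norm values form a group. The case of two non-norms is where index at most two enters:
r a and r a' are norm values, hence so is a a' r². -/
theorem hilbertSymbol_mul_left (ha : a ≠ 0) (ha' : a' ≠ 0) (hb : b ≠ 0) :
    hilbertSymbol p (a * a') b = hilbertSymbol p a b * hilbertSymbol p a' b := by
  have h1 := hilbertSymbol_eq_one_iff (a := a) hb
  have h2 := hilbertSymbol_eq_one_iff (a := a') hb
  have h3 := hilbertSymbol_eq_one_iff (a := a * a') hb
  have hneg : ∀ {x : ℚ_[p]}, hilbertSymbol p x b ≠ 1 → hilbertSymbol p x b = -1 := fun h =>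
    (hilbertSymbol_eq_or _ _).resolve_left h
  by_cases hN : IsNormValue b a <;> by_cases hN' : IsNormValue b a'
  · rw [h1.mpr hN, h2.mpr hN', h3.mpr (hN.mul hN'), one_mul]
  · have : ¬ IsNormValue b (a * a') := fun h => hN' (isNormValue_of_mul_left hN ha h)
    rw [h1.mpr hN, hneg (mt h2.mp hN'), hneg (mt h3.mp this), one_mul]
  · have : ¬ IsNormValue b (a * a') := fun h =>
      hN (isNormValue_of_mul_left hN' ha' (by rwa [mul_comm]))
    rw [h2.mpr hN', hneg (mt h1.mp hN), hneg (mt h3.mp this), mul_one]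
  · obtain ⟨r, hr, h⟩ := exists_isNormValue_or_mul hb
    have := ((h a ha).resolve_left hN).mul ((h a' ha').resolve_left hN')
    rw [show r * a * (r * a') = a * a' * r ^ 2 by ring, isNormValue_mul_sq_iff hr] at this
    rw [h3.mpr this, hneg (mt h1.mp hN), hneg (mt h2.mp hN')]
    norm_num

end HilbertSymbol

/-! ### The twisted extension that carries the Hasse–Witt invariant -/

/-- A symmetric bimultiplicative pairing with values in `{1, -1}`. -/
structure SignPairing (G : Type*) [CommGroup G] where
  /-- the underlying bimultiplicative map -/
  toHom : G →* G →* ℤ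
  symm : ∀ a b, toHom a b = toHom b a
  mul_self : ∀ a b, toHom a b * toHom a b = 1

/-- The central extension of `G` by signs with cocycle `β`. -/
@[ext]
structure TwistedProduct {G : Type*} [CommGroup G] (β : SignPairing G) where
  /-- the component in `G` -/
  fst : G
  /-- the sign -/
  snd : ℤ

namespace TwistedProduct

variable {G : Type*} [CommGroup G] {β : SignPairing G}

instance : Mul (TwistedProduct β) where
  mul x y := ⟨x.1 * y.1, x.2 * y.2 * β.toHom x.1 y.1⟩

instance : One (TwistedProduct β) where
  one := ⟨1, 1⟩

theorem fst_mul (x y : TwistedProduct β) : (x * y).1 = x.1 * y.1 := rfl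

theorem snd_mul (x y : TwistedProduct β) : (x * y).2 = x.2 * y.2 * β.toHom x.1 y.1 := rfl

theorem fst_one : (1 : TwistedProduct β).1 = 1 := rfl

theorem snd_one : (1 : TwistedProduct β).2 = 1 := rfl

instance : CommMonoid (TwistedProduct β) where
  mul_assoc x y z := by
    ext
    · simp only [fst_mul, mul_assoc]
    · simp only [snd_mul, fst_mul, map_mul, MonoidHom.mul_apply]
      ring
  one_mul x := by ext <;> simp [fst_mul, snd_mul, fst_one, snd_one]
  mul_one x := by ext <;> simp [fst_mul, snd_mul, fst_one, snd_one]
  mul_comm x y := by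
    ext
    · simp only [fst_mul, mul_comm]
    · rw [snd_mul, snd_mul, β.symm, mul_comm x.2]

theorem toHom_mul_sq_left (a b c : G) : β.toHom (a * c ^ 2) b = β.toHom a b := by
  rw [map_mul, map_pow, MonoidHom.mul_apply, MonoidHom.pow_apply, pow_two, β.mul_self, mul_one]

variable (β) in
/-- The congruence on the extension that identifies elements of `G` up to squares. -/
def conSquares : Con (TwistedProduct β) where
  r x y := y.2 = x.2 ∧ ∃ c, y.1 = x.1 * c ^ 2
  iseqv := by
    refine ⟨fun x => ⟨rfl, 1, by simp⟩, ?_, ?_⟩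
    · rintro x y ⟨h, c, hc⟩
      exact ⟨h.symm, c⁻¹, by rw [hc, mul_assoc, ← mul_pow]; simp⟩
    · rintro x y z ⟨h, c, hc⟩ ⟨h', c', hc'⟩
      exact ⟨h'.trans h, c * c', by rw [hc', hc, mul_assoc, ← mul_pow]⟩
  mul' := by
    rintro w x y z ⟨h, c, hc⟩ ⟨h', c', hc'⟩
    refine ⟨?_, c * c', ?_⟩
    · rw [snd_mul, snd_mul, h, h', hc, hc', toHom_mul_sq_left, β.symm, toHom_mul_sq_left, β.symm]
    · rw [fst_mul, fst_mul, hc, hc', mul_pow, mul_mul_mul_comm]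

variable (β) in
/-- The lift of an element of `G` with trivial sign. -/
def of (a : G) : TwistedProduct β := ⟨a, 1⟩

theorem fst_prod_of (g : Fin n → G) : (∏ i, of β (g i)).1 = ∏ i, g i := by
  induction n with
  | zero => rfl
  | succ n ih => rw [Fin.prod_univ_succ, fst_mul, ih, Fin.prod_univ_succ, of]

/-- Multiplying out the lifts collects one cocycle value for every pair i < j, which is exactly the
shape of the Hasse–Witt product. -/
theorem snd_prod_of (g : Fin n → G) :
    (∏ i, of β (g i)).2 = ∏ i, ∏ j ∈ Finset.Ioi i, β.toHom (g i) (g j) := by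
  induction n with
  | zero => rfl
  | succ n ih =>
    rw [Fin.prod_univ_succ, snd_mul, ih, fst_prod_of, Fin.prod_univ_succ, Fin.prod_Ioi_zero]
    simp only [Fin.prod_Ioi_succ, of, map_prod]
    ring

end TwistedProduct

section HasseWitt

variable (p : ℕ) [hp : Fact p.Prime]

/-- The Hilbert symbol as a pairing on the group `ℚ_pˣ`. -/
def hilbertPairing : SignPairing ℚ_[p]ˣ where
  toHom :=
    { toFun := fun a =>
        { toFun := fun b => hilbertSymbol p a b
          map_one' := by
            rw [hilbertSymbol_comm]
            exact (hilbertSymbol_eq_one_iff a.ne_zero).mpr ⟨1, 0, by simp⟩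
          map_mul' := fun b c => by
            rw [hilbertSymbol_comm, Units.val_mul, hilbertSymbol_mul_left b.ne_zero c.ne_zero
              a.ne_zero, hilbertSymbol_comm, hilbertSymbol_comm (c : ℚ_[p])] }
      map_one' := by
        ext b
        exact (hilbertSymbol_eq_one_iff b.ne_zero).mpr ⟨1, 0, by simp⟩
      map_mul' := fun a b => by
        ext c
        exact hilbertSymbol_mul_left a.ne_zero b.ne_zero c.ne_zero }
  symm a b := hilbertSymbol_comm _ _
  mul_self a b := hilbertSymbol_mul_self _ _

theorem hilbertPairing_apply (a b : ℚ_[p]ˣ) :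
    (hilbertPairing p).toHom a b = hilbertSymbol p a b := rfl

-- With s = a + b one has (as, bs) = 1, because as = s² - bs · 1². Expanding bimultiplicatively
-- gives the identity.
variable {p} in
theorem hilbertSymbol_eq_hilbertSymbol_add {a b : ℚ_[p]} (ha : a ≠ 0) (hb : b ≠ 0)
    (hab : a + b ≠ 0) :
    hilbertSymbol p a b = hilbertSymbol p (a + b) (a * b * (a + b)) := by
  set s := a + b with hs
  have hm : ∀ {x y z : ℚ_[p]}, x ≠ 0 → y ≠ 0 → z ≠ 0 →
      hilbertSymbol p x (y * z) = hilbertSymbol p x y * hilbertSymbol p x z := by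
    intro x y z hx hy hz
    rw [hilbertSymbol_comm, hilbertSymbol_mul_left hy hz hx, hilbertSymbol_comm,
      hilbertSymbol_comm z]
  have h1 : hilbertSymbol p (a * s) (b * s) = 1 := by
    refine (hilbertSymbol_eq_one_iff (mul_ne_zero hb hab)).mpr ⟨s, 1, ?_⟩
    rw [hs]
    ring
  rw [hilbertSymbol_mul_left ha hab (mul_ne_zero hb hab), hm ha hb hab, hm hab hb hab] at h1
  rw [hm hab (mul_ne_zero ha hb) hab, hm hab ha hb, hilbertSymbol_comm s a]
  have h2 := hilbertSymbol_mul_self (p := p) a b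
  linear_combination (hilbertSymbol p a s * hilbertSymbol p s b * hilbertSymbol p s s) * h2
    - hilbertSymbol p a b * h1

/-- The class of the form `a x²` in the group that carries the discriminant and the Hasse–Witt
invariant. -/
def hasseWittClass (a : ℚ) : (TwistedProduct.conSquares (hilbertPairing p)).Quotient :=
  if h : a ≠ 0 then (TwistedProduct.conSquares (hilbertPairing p)).mk'
    (TwistedProduct.of _ (Units.mk0 (a : ℚ_[p]) (Rat.cast_ne_zero.mpr h))) else 1

/-- In the binary relation the first coordinates ab and ab(a+b)² agree up to squares, and the signs
agree by `hilbertSymbol_eq_hilbertSymbol_add`. -/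
theorem isWittInvariant_hasseWittClass : IsWittInvariant (hasseWittClass p) where
  mul_sq a c ha hc := by
    rw [hasseWittClass, hasseWittClass, dif_pos ha,
      dif_pos (mul_ne_zero ha (pow_ne_zero 2 hc))]
    refine Eq.symm ((Con.eq _).mpr ⟨rfl, Units.mk0 (c : ℚ_[p]) (Rat.cast_ne_zero.mpr hc), ?_⟩)
    ext
    simp [TwistedProduct.of]
  binary a b ha hb hab := by
    have ha' : (a : ℚ_[p]) ≠ 0 := by exact_mod_cast ha
    have hb' : (b : ℚ_[p]) ≠ 0 := by exact_mod_cast hb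
    have hab' : ((a + b : ℚ) : ℚ_[p]) ≠ 0 := by exact_mod_cast hab
    rw [hasseWittClass, hasseWittClass, hasseWittClass, hasseWittClass, dif_pos ha, dif_pos hb,
      dif_pos hab, dif_pos (mul_ne_zero (mul_ne_zero ha hb) hab), ← map_mul, ← map_mul]
    refine (Con.eq _).mpr ⟨?_, Units.mk0 _ hab', ?_⟩
    · rw [TwistedProduct.snd_mul, TwistedProduct.snd_mul]
      congr 1
      have := hilbertSymbol_eq_hilbertSymbol_add ha' hb' (by exact_mod_cast hab')
      simp only [TwistedProduct.of, hilbertPairing_apply, Units.val_mk0]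
      push_cast
      exact this.symm
    · rw [TwistedProduct.fst_mul, TwistedProduct.fst_mul]
      ext
      simp [TwistedProduct.of]
      ring

/-- The Hasse–Witt invariant is an isometry invariant. -/
theorem hasseWitt_eq_of_equivalent {d d' : Fin n → ℚ} (hd : ∀ i, d i ≠ 0) (hd' : ∀ i, d' i ≠ 0)
    (h : (QuadraticMap.weightedSumSquares ℚ d).Equivalent (QuadraticMap.weightedSumSquares ℚ d')) :
    hasseWitt p d = hasseWitt p d' := by
  have hc : ∀ {d : Fin n → ℚ} (hd : ∀ i, d i ≠ 0), ∏ i, hasseWittClass p (d i)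
      = (TwistedProduct.conSquares (hilbertPairing p)).mk'
        (∏ i, TwistedProduct.of _ (Units.mk0 (d i : ℚ_[p]) (by exact_mod_cast hd i))) := by
    intro d hd
    rw [map_prod]
    refine Finset.prod_congr rfl fun i _ => ?_
    rw [hasseWittClass, dif_pos (hd i)]
  have h1 := (isWittInvariant_hasseWittClass p).prod_eq_prod hd hd' h
  rw [hc hd, hc hd'] at h1
  have h2 := ((Con.eq _).mp h1).1
  rw [TwistedProduct.snd_prod_of, TwistedProduct.snd_prod_of] at h2
  exact h2.symm

end HasseWitt

/-! ### Scaling of the Hasse–Witt invariant, and the conclusion -/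

theorem prod_prod_Ioi_mul {M : Type*} [CommMonoid M] (k : M) (f : Fin n → M) :
    ∏ i, ∏ j ∈ Finset.Ioi i, k * (f i * f j) = k ^ n.choose 2 * (∏ i, f i) ^ (n - 1) := by
  induction n with
  | zero => simp
  | succ n ih =>
    rw [Fin.prod_univ_succ, Fin.prod_Ioi_zero]
    simp only [Fin.prod_Ioi_succ]
    rw [ih, Finset.prod_mul_distrib, Finset.prod_mul_distrib, Finset.prod_const,
      Finset.prod_const, Finset.card_univ, Fintype.card_fin, Fin.prod_univ_succ,
      Nat.choose_succ_succ' n 1, Nat.choose_one_right, Nat.add_sub_cancel, pow_add, mul_pow]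
    cases n with
    | zero => simp
    | succ n =>
      rw [Nat.add_sub_cancel, pow_succ (∏ i : Fin (n + 1), f i.succ)]
      ac_rfl

/-- Expanding (c dᵢ, c dⱼ) gives the extra factor (c,c)^(n choose 2) (c,∏dᵢ)^(n-1), and both
exponents are even when n ≡ 1 mod 4. -/
theorem hasseWitt_const_mul (p : ℕ) [Fact p.Prime] (hn : n % 4 = 1) {c : ℚ} (hc : c ≠ 0)
    {d : Fin n → ℚ} (hd : ∀ i, d i ≠ 0) :
    hasseWitt p (fun i => c * d i) = hasseWitt p d := by
  let C : ℚ_[p]ˣ := Units.mk0 (c : ℚ_[p]) (by exact_mod_cast hc)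
  let g : Fin n → ℚ_[p]ˣ := fun i => Units.mk0 (d i : ℚ_[p]) (by exact_mod_cast hd i)
  let β := (hilbertPairing p).toHom
  have h1 : ∀ i j, hilbertSymbol p ((c * d i : ℚ) : ℚ_[p]) ((c * d j : ℚ) : ℚ_[p])
      = β C C * (β C (g i) * β C (g j)) * hilbertSymbol p (d i : ℚ_[p]) (d j : ℚ_[p]) := by
    intro i j
    have : hilbertSymbol p ((c * d i : ℚ) : ℚ_[p]) ((c * d j : ℚ) : ℚ_[p])
        = β (C * g i) (C * g j) := by
      push_cast
      rfl
    rw [this, map_mul, map_mul, MonoidHom.mul_apply, MonoidHom.mul_apply,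
      show β (g i) C = β C (g i) from (hilbertPairing p).symm _ _]
    change _ = _ * β (g i) (g j)
    ring
  unfold hasseWitt
  simp only [h1, Finset.prod_mul_distrib]
  have h2 := prod_prod_Ioi_mul (β C C) fun i => β C (g i)
  simp only [Finset.prod_mul_distrib] at h2
  rw [h2]
  obtain ⟨m, rfl⟩ : ∃ m, n = 4 * m + 1 := ⟨n / 4, by omega⟩
  have hch : (4 * m + 1).choose 2 = 2 * (m * (4 * m + 1)) := by
    rw [Nat.choose_two_right, Nat.add_sub_cancel]
    apply Nat.div_eq_of_eq_mul_left two_pos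
    ring
  have hsq : ∀ x, β C x ^ 2 = 1 := fun x => by rw [pow_two]; exact (hilbertPairing p).mul_self _ _
  rw [hch, Nat.add_sub_cancel, ← Finset.prod_pow, pow_mul, hsq, one_pow,
    Finset.prod_eq_one (fun i _ => by
      rw [show 4 * m = 2 * (2 * m) by ring, pow_mul, hsq, one_pow])]
  simp

/-- A zero diagonal entry would give a non-zero vector in the radical of q, against det Q ≠ 0. -/
theorem IsDiagonalForm.ne_zero {Q : Matrix (Fin n) (Fin n) ℚ} {d : Fin n → ℚ} (hQ : Q.IsSymm)
    (hdet : Q.det ≠ 0) (h : IsDiagonalForm Q d) (i : Fin n) : d i ≠ 0 := by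
  intro hi
  obtain ⟨T⟩ := h
  have hT : ∀ x, form Q (T.symm x) = QuadraticMap.weightedSumSquares ℚ d x := fun x =>
    T.symm.map_app x
  set v := T.symm (Pi.single i 1) with hv
  have hadd : ∀ y, form Q (v + y) = form Q v + form Q y := by
    intro y
    obtain ⟨x, rfl⟩ := T.symm.toLinearEquiv.surjective y
    change form Q (v + T.symm x) = form Q v + form Q (T.symm x)
    have : v + T.symm x = T.symm (Pi.single i 1 + x) :=
      (map_add T.symm.toLinearEquiv _ _).symm
    rw [this, hv, hT, hT, hT, weightedSumSquares_single, hi, zero_add,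
      QuadraticMap.weightedSumSquares_apply, QuadraticMap.weightedSumSquares_apply]
    refine Finset.sum_congr rfl fun j _ => ?_
    by_cases hj : j = i
    · simp [hj, hi]
    · simp [hj]
  have hQv : Q *ᵥ v = 0 := by
    refine dotProduct_eq_zero _ fun y => ?_
    have := hadd y
    simp only [form_apply, mulVec_add, add_dotProduct, dotProduct_add,
      dotProduct_mulVec_comm hQ v y] at this
    rw [dotProduct_comm]
    linear_combination (1 / 2) * this
  have hv0 : v = 0 := by
    by_contra h0
    exact hdet (Matrix.exists_mulVec_eq_zero_iff.mp ⟨v, h0, hQv⟩)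
  have : (Pi.single i 1 : Fin n → ℚ) = 0 := by
    apply T.symm.toLinearEquiv.injective
    rw [map_zero]
    exact hv0
  simpa using congrFun this i

theorem smul_weightedSumSquares (c : ℚ) (d : Fin n → ℚ) :
    c • QuadraticMap.weightedSumSquares ℚ d = QuadraticMap.weightedSumSquares ℚ fun i => c * d i := by
  ext x
  simp [QuadraticMap.weightedSumSquares_apply, Finset.mul_sum, mul_assoc]

theorem equivalent_const_smul {V W : Type*} [AddCommGroup V] [Module ℚ V] [AddCommGroup W]
    [Module ℚ W] {q : QuadraticForm ℚ V} {q' : QuadraticForm ℚ W} (h : q.Equivalent q') (c : ℚ) :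
    (c • q).Equivalent (c • q') := by
  obtain ⟨T⟩ := h
  refine ⟨⟨T.toLinearEquiv, fun v => ?_⟩⟩
  change c * q' (T v) = c * q v
  rw [T.map_app]

end OrthogonalForms

end

open OrthogonalForms in
theorem mainTheorem2 {K : Type*} [Field K] [CharZero K] {n : ℕ}
    (Q₁ Q₂ : Matrix (Fin n) (Fin n) ℚ) (hQ₁ : Q₁.IsSymm) (hQ₂ : Q₂.IsSymm)
    (Γ₁ : Subgroup (SO K Q₁)) (Γ₂ : Subgroup (SO K Q₂))
    (hΓ₁ : Γ₁ ≤ integralPoints K Q₁) (hΓ₂ : Γ₂ ≤ integralPoints K Q₂)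
    (hd₁ : IsZariskiDense Γ₁) (hd₂ : IsZariskiDense Γ₂) :
    (∀ φ : SO K Q₁ →* SO K Q₂, IsConjugation φ → IsZariskiDense (Γ₁.map φ ⊓ Γ₂) →
      IsDefinedOverRat φ ∧
      (Q₁.det ≠ 0 → Q₂.det ≠ 0 → Odd n →
        SimilarForms Q₁ Q₂ ∧ (SameDiscriminant Q₁ Q₂ → IsometricForms Q₁ Q₂))) ∧
    (Q₁.det ≠ 0 → Q₂.det ≠ 0 → (n % 4 = 1 ∨ (Odd n ∧ SameDiscriminant Q₁ Q₂)) →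
      ∀ d₁ d₂ : Fin n → ℚ, IsDiagonalForm Q₁ d₁ → IsDiagonalForm Q₂ d₂ →
        (∃ (p : ℕ) (_ : Fact p.Prime), hasseWitt p d₁ ≠ hasseWitt p d₂) →
          ¬ ∃ φ : SO K Q₁ →* SO K Q₂, IsConjugation φ ∧ IsZariskiDense (Γ₁.map φ ⊓ Γ₂)) := by
  have part1 : ∀ φ : SO K Q₁ →* SO K Q₂, IsConjugation φ → IsZariskiDense (Γ₁.map φ ⊓ Γ₂) →
      IsDefinedOverRat φ ∧
      (Q₁.det ≠ 0 → Q₂.det ≠ 0 → Odd n →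
        SimilarForms Q₁ Q₂ ∧ (SameDiscriminant Q₁ Q₂ → IsometricForms Q₁ Q₂)) := by
    intro φ hφ hd
    obtain ⟨h, hdet, hx⟩ := exists_rat_conjugator hΓ₁ hΓ₂ hφ hd
    exact ⟨isDefinedOverRat_of_conjugator hdet hx,
      fun h₁ h₂ hn => similarForms_of_conjugator hQ₁ hQ₂ h₁ h₂ hn hdet hx⟩
  refine ⟨part1, ?_⟩
  rintro h₁ h₂ hn d₁ d₂ hd₁' hd₂' ⟨p, hp, hne⟩ ⟨φ, hφ, hd⟩
  have hodd : Odd n := by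
    rcases hn with hn | hn
    · exact Nat.odd_iff.mpr (by omega)
    · exact hn.1
  obtain ⟨⟨c, hc, hsim⟩, hiso⟩ := (part1 φ hφ hd).2 h₁ h₂ hodd
  have hd₁0 := hd₁'.ne_zero hQ₁ h₁
  have hd₂0 := hd₂'.ne_zero hQ₂ h₂
  apply hne
  rcases hn with hn | ⟨-, hn⟩
  -- Here q₁ is only similar to q₂, so d₁ is compared with c d₂, which has the same invariant as d₂.
  · rw [← hasseWitt_const_mul p hn hc hd₂0]
    refine hasseWitt_eq_of_equivalent p hd₁0 (fun i => mul_ne_zero hc (hd₂0 i)) ?_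
    rw [← smul_weightedSumSquares]
    exact hd₁'.symm.trans (hsim.trans (equivalent_const_smul hd₂' c))
  · exact hasseWitt_eq_of_equivalent p hd₁0 hd₂0 (hd₁'.symm.trans ((hiso hn).trans hd₂'))
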